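/- Let $n\in\mathbb N$, $\hbar>0$, and let $\mathcal H=L^2(\mathbb R^n)$ carry the usual position and momentum operators $\vec Q=(Q_1,\dots,Q_n)$, $\vec P=-i\hbar\nabla$, with Weyl operators $W(\vec x,\vec p)=\exp\{\frac i\hbar(\vec p\cdot\vec Q-\vec x\cdot\vec P)\}$, also written $W(z)$ for $z=(\vec x,\vec p)\in\mathbb R^{2n}$. Let $\Omega=\begin{pmatrix}0&\hbar\mathbb 1\\-\hbar\mathbb 1&0\end{pmatrix}$. Let $\vec u,\vec v\in\mathbb R^n$ be unit vectors with $\vec u\cdot\vec v=\cos\alpha$; for a state $\rho$ (a positive operator of trace one) let $\mathsf Q_{\vec u,\rho}$ and $\mathsf P_{\vec v,\rho}$ be the distributions of $\vec u\cdot\vec Q$ and $\vec v\cdot\vec P$ in $\rho$. Logarithms $\log$ are to base $2$. A state $\rho$ is *Gaussian* if $\operatorname{Tr}\{\rho W(-\Omega w)\}=\exp\{i\,w^T\mu-\frac12 w^TVw\}$ for all $w\in\mathbb R^{2n}$, for some $\mu\in\mathbb R^{2n}$ and some real symmetric $2n\times 2n$ matrix $V$ with $V+\frac i2\Omega\ge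 0$. A POVM $\mathsf M$ on $\mathbb R^2$ is *$(\vec u,\vec v)$-covariant* if $W(\vec x,\vec p)\mathsf M(Z)W(\vec x,\vec p)^*=\mathsf M\big(Z+(\vec u\cdot\vec x,\vec v\cdot\vec p)\big)$ for all Borel sets $Z\subseteq\mathbb R^2$ and all $\vec x,\vec p\in\mathbb R^n$, and it is *Gaussian* with parameters $\big((a^{\mathsf M},b^{\mathsf M}),V^{\mathsf M},J^{\mathsf M}\big)$, where $V^{\mathsf M}$ is a real symmetric $2\times2$ matrix and $J^{\mathsf M}$ a real $2\times 2n$ matrix with $V^{\mathsf M}\pm\frac i2J^{\mathsf M}\Omega (J^{\mathsf M})^T\ge0$, if for all $w=(k,l)\in\mathbb R^2$ $$\int_{\mathbb R^2} e^{i(kx+lp)}\,\mathsf M(dx\,dp)=W\big(-\Omega (J^{\mathsf M})^Tw\big)\exp\Big\{i(ka^{\mathsf M}+lb^{\mathsf M})-\tfrac12w^TV^{\mathsf M}w\Big\}.$$ Write $\mathsf M_{1,\rho},\mathsf M_{2,\rho}$ for the marginals of the distribution $\mathsf M_\rho(Z)=\operatorname{Tr}\{\rho\mathsf M(Z)\}$.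 With the relative entropy $S(p\|q)=\int\log\frac{dp}{dq}\,dp\in[0,+\infty]$, let $$S(\rho,\mathsf M)=S(\mathsf Q_{\vec u,\rho}\|\mathsf M_{1,\rho})+S(\mathsf P_{\vec v,\rho}\|\mathsf M_{2,\rho}),$$ and for $\varepsilon_1,\varepsilon_2>0$ let $$D^G_{\varepsilon}(\mathsf M)=\sup\big\{S(\rho,\mathsf M):\ \rho\text{ a Gaussian state},\ \operatorname{Var}(\mathsf Q_{\vec u,\rho})\ge\varepsilon_1,\ \operatorname{Var}(\mathsf P_{\vec v,\rho})\ge\varepsilon_2\big\}.$$ Let $s(x)=\ln(1+x)-\frac x{1+x}$ for $x\ge 0$, and for $c_1,c_2>0$ let $$E(c_1,c_2)=\frac{\log e}2\left[s\!\left(\frac{V^{\mathsf M}_{11}}{c_1}\right)+s\!\left(\frac{V^{\mathsf M}_{22}}{c_2}\right)+\frac{(a^{\mathsf M})^2}{V^{\mathsf M}_{11}+c_1}+\frac{(b^{\mathsf M})^2}{V^{\mathsf M}_{22}+c_2}\right].$$ **Theorem.** Let $\varepsilon_1,\varepsilon_2>0$ and let $\mathsf M$ be a Gaussian $(\vec u,\vec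 v)$-covariant POVM on $\mathbb R^2$ with parameters $\big((a^{\mathsf M},b^{\mathsf M}),V^{\mathsf M},J^{\mathsf M}\big)$. (i) If $\varepsilon_1\varepsilon_2\ge\frac{\hbar^2}4(\cos\alpha)^2$, then there are Gaussian states $\rho_\varepsilon$ with $\operatorname{Var}(\mathsf Q_{\vec u,\rho_\varepsilon})=\varepsilon_1$ and $\operatorname{Var}(\mathsf P_{\vec v,\rho_\varepsilon})=\varepsilon_2$, and every such state satisfies $$D^G_{\varepsilon}(\mathsf M)=S(\rho_\varepsilon,\mathsf M)=E(\varepsilon_1,\varepsilon_2).$$ (ii) If $\varepsilon_1\varepsilon_2<\frac{\hbar^2}4(\cos\alpha)^2$, then there are Gaussian states $\rho_\varepsilon$ with $\operatorname{Var}(\mathsf Q_{\vec u,\rho_\varepsilon})=\varepsilon_1$ and $\operatorname{Var}(\mathsf P_{\vec v,\rho_\varepsilon})=\frac{\hbar^2}{4\varepsilon_1}(\cos\alpha)^2$, and every such state satisfies $$D^G_{\varepsilon}(\mathsf M)\ge S(\rho_\varepsilon,\mathsf M)=E\Big(\varepsilon_1,\frac{\hbar^2}{4\varepsilon_1}(\cos\alpha)^2\Big).$$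 -/

import Mathlib

open MeasureTheory ProbabilityTheory
open scoped ENNReal Matrix ComplexOrder

noncomputable section

namespace QM

/-! ### States, observables and their outcome distributions on a Hilbert space -/

section General

variable {H : Type*} [NormedAddCommGroup H] [InnerProductSpace ℂ H]

theorem re_inner_nonneg {T : H →L[ℂ] H} (hT : T.IsPositive) (ψ : H) :
    0 ≤ (inner ℂ ψ (T ψ)).re := hT.re_inner_nonneg_right ψ

variable (H) in
/-- Positive operator valued measures on `X` with values in the bounded operators of `H`
(countable additivity is in the weak operator topology). -/
structure POVM (X : Type*) [MeasurableSpace X] where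
  op : Set X → H →L[ℂ] H
  pos : ∀ Z, MeasurableSet Z → (op Z).IsPositive
  op_univ : op Set.univ = 1
  hasSum_iUnion : ∀ Z : ℕ → Set X, (∀ i, MeasurableSet (Z i)) →
    Pairwise (Function.onFun Disjoint Z) → ∀ φ ψ : H,
      HasSum (fun i => inner ℂ φ (op (Z i) ψ)) (inner ℂ φ (op (⋃ i, Z i) ψ))

variable {X Y : Type*} [MeasurableSpace X] [MeasurableSpace Y]

theorem POVM.op_empty (M : POVM H X) : M.op ∅ = 0 := by
  ext ψ
  refine ext_inner_left ℂ fun φ => ?_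
  have h := M.hasSum_iUnion (fun _ => ∅) (fun _ => MeasurableSet.empty)
    (fun i j _ => by simp [Function.onFun]) φ ψ
  have h0 := h.summable.tendsto_atTop_zero
  simpa using (tendsto_nhds_unique h0 tendsto_const_nhds).symm

/-- The positive measure `Z ↦ ⟨ψ, M(Z) ψ⟩`. -/
def POVM.scalarMeasure (M : POVM H X) (ψ : H) : Measure X :=
  Measure.ofMeasurable (fun Z _ => ENNReal.ofReal (inner ℂ ψ (M.op Z ψ)).re)
    (by simp [M.op_empty])
    (by
      intro Z hZ hd
      have h := Complex.hasSum_re (M.hasSum_iUnion Z hZ hd ψ ψ)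
      rw [← h.tsum_eq]
      exact ENNReal.ofReal_tsum_of_nonneg (fun i => re_inner_nonneg (M.pos _ (hZ i)) ψ)
        h.summable)

theorem POVM.scalarMeasure_apply (M : POVM H X) (ψ : H) {Z : Set X} (hZ : MeasurableSet Z) :
    M.scalarMeasure ψ Z = ENNReal.ofReal (inner ℂ ψ (M.op Z ψ)).re :=
  Measure.ofMeasurable_apply Z hZ

variable [CompleteSpace H]

variable (H) in
/-- The index set of a fixed Hilbert basis of `H`. -/
def BasisIdx : Set H := (exists_hilbertBasis ℂ H).choose

variable (H) in
/-- A fixed Hilbert basis of `H`, used to compute traces. -/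
def basis : HilbertBasis (BasisIdx H) ℂ H := (exists_hilbertBasis ℂ H).choose_spec.choose

/-- The trace `Tr T = ∑ᵢ ⟨eᵢ, T eᵢ⟩`. It is only applied to trace class operators, for which the
value does not depend on the Hilbert basis. -/
def tr (T : H →L[ℂ] H) : ℂ := ∑' i, inner ℂ (basis H i) (T (basis H i))

variable (H) in
/-- States (statistical operators): positive operators of trace one. -/
structure State where
  op : H →L[ℂ] H
  pos : op.IsPositive
  trace_one : HasSum (fun i => inner ℂ (basis H i) (op (basis H i))) 1

theorem sqrt_mul_sqrt (ρ : State H) : CFC.sqrt ρ.op * CFC.sqrt ρ.op = ρ.op :=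
  CFC.sqrt_mul_sqrt_self ρ.op
    ((ContinuousLinearMap.nonneg_iff_isPositive _).2 ρ.pos)

theorem inner_sqrt (ρ : State H) (x y : H) :
    inner ℂ (CFC.sqrt ρ.op x) y = inner ℂ x (CFC.sqrt ρ.op y) := by
  have h : (CFC.sqrt ρ.op).IsPositive :=
    (ContinuousLinearMap.nonneg_iff_isPositive _).1 (CFC.sqrt_nonneg ρ.op)
  exact h.isSymmetric x y

theorem parseval (x : H) : HasSum (fun i => ‖inner ℂ (basis H i) x‖ ^ 2) (‖x‖ ^ 2) := by
  have h := Complex.hasSum_re ((basis H).hasSum_inner_mul_inner x x)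
  have e : (inner ℂ x x : ℂ).re = ‖x‖ ^ 2 := by
    simpa using inner_self_eq_norm_sq (𝕜 := ℂ) x
  rw [e] at h
  convert h using 2 with i
  rw [← inner_conj_symm x (basis H i), mul_comm, Complex.mul_conj, Complex.normSq_eq_norm_sq,
    Complex.ofReal_re]

/-- `Tr (ρ T) = ∑ⱼ ⟨√ρ eⱼ, T √ρ eⱼ⟩`. -/
theorem hasSum_tr (ρ : State H) (T : H →L[ℂ] H) :
    HasSum (fun j => inner ℂ (CFC.sqrt ρ.op (basis H j)) (T (CFC.sqrt ρ.op (basis H j))))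
      (tr (ρ.op * T)) := by
  set S := CFC.sqrt ρ.op with hS
  set b := basis H
  set A := ContinuousLinearMap.adjoint T
  have hsqrt : ∀ i, ‖S (b i)‖ ^ 2 = (inner ℂ (b i) (ρ.op (b i))).re := by
    intro i
    have h1 : inner ℂ (S (b i)) (S (b i)) = inner ℂ (b i) (ρ.op (b i)) := by
      rw [hS, inner_sqrt]
      conv_rhs => rw [← sqrt_mul_sqrt ρ]
      rfl
    have h2 := inner_self_eq_norm_sq (𝕜 := ℂ) (S (b i))
    rw [h1] at h2
    simpa using h2.symm
  have hS1 : Summable fun j => ‖S (b j)‖ ^ 2 := by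
    simp_rw [hsqrt]
    exact (Complex.hasSum_re ρ.trace_one).summable
  have hA1 : Summable fun j => ‖A (S (b j))‖ ^ 2 := by
    refine Summable.of_nonneg_of_le (fun j => sq_nonneg _) (fun j => ?_)
      (hS1.mul_left (‖A‖ ^ 2))
    rw [← mul_pow]
    exact pow_le_pow_left₀ (norm_nonneg _) (A.le_opNorm _) 2
  have hprod : ∀ g : BasisIdx H → H, (Summable fun j => ‖g j‖ ^ 2) →
      Summable fun p : BasisIdx H × BasisIdx H => ‖inner ℂ (b p.2) (g p.1)‖ ^ 2 := by
    intro g hg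
    refine (summable_prod_of_nonneg (fun p => sq_nonneg _)).2 ⟨fun j => (parseval (g j)).summable, ?_⟩
    simpa only [b, (parseval _).tsum_eq] using hg
  have hsum : Summable fun p : BasisIdx H × BasisIdx H =>
      inner ℂ (A (S (b p.1))) (b p.2) * inner ℂ (b p.2) (S (b p.1)) := by
    refine Summable.of_norm_bounded ((hprod _ hA1).add (hprod _ hS1)) fun p => ?_
    rw [norm_mul, norm_inner_symm]
    nlinarith [sq_nonneg (‖inner ℂ (b p.2) (A (S (b p.1)))‖ - ‖inner ℂ (b p.2) (S (b p.1))‖),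
      sq_nonneg ‖inner ℂ (b p.2) (A (S (b p.1)))‖, sq_nonneg ‖inner ℂ (b p.2) (S (b p.1))‖]
  have hrow : ∀ j, HasSum (fun i => inner ℂ (A (S (b j))) (b i) * inner ℂ (b i) (S (b j)))
      (inner ℂ (S (b j)) (T (S (b j)))) := by
    intro j
    have h := b.hasSum_inner_mul_inner (A (S (b j))) (S (b j))
    rwa [ContinuousLinearMap.adjoint_inner_left] at h
  have hcol : ∀ i, HasSum (fun j => inner ℂ (A (S (b j))) (b i) * inner ℂ (b i) (S (b j)))
      (inner ℂ (b i) ((ρ.op * T) (b i))) := by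
    intro i
    have h := b.hasSum_inner_mul_inner (S (b i)) (S (T (b i)))
    have e : inner ℂ (S (b i)) (S (T (b i))) = inner ℂ (b i) ((ρ.op * T) (b i)) := by
      rw [hS, inner_sqrt]
      conv_rhs => rw [← sqrt_mul_sqrt ρ]
      rfl
    rw [e] at h
    convert! h using 2 with j
    rw [ContinuousLinearMap.adjoint_inner_left, hS, inner_sqrt, inner_sqrt, mul_comm]
  have h1 := hsum.hasSum.prod_fiberwise hrow
  have h2 := ((Equiv.prodComm _ _).hasSum_iff.2 hsum.hasSum).prod_fiberwise hcol
  have h3 : tr (ρ.op * T) = _ := h2.tsum_eq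
  rw [h3]
  exact h1

/-- The outcome distribution `Z ↦ Tr (ρ M(Z))` of the observable `M` in the state `ρ`. -/
def POVM.distr (M : POVM H X) (ρ : State H) : Measure X :=
  Measure.ofMeasurable (fun Z _ => ENNReal.ofReal (tr (ρ.op * M.op Z)).re)
    (by simp [M.op_empty, tr])
    (by
      intro Z hZ hd
      have key : ∀ W, MeasurableSet W → ENNReal.ofReal (tr (ρ.op * M.op W)).re
          = ∑' j, M.scalarMeasure (CFC.sqrt ρ.op (basis H j)) W := by
        intro W hW
        have h := Complex.hasSum_re (hasSum_tr ρ (M.op W))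
        rw [← h.tsum_eq, ENNReal.ofReal_tsum_of_nonneg
          (fun i => re_inner_nonneg (M.pos W hW) _) h.summable]
        exact tsum_congr fun j => (M.scalarMeasure_apply _ hW).symm
      rw [key _ (MeasurableSet.iUnion hZ)]
      simp_rw [measure_iUnion hd hZ]
      rw [ENNReal.tsum_comm]
      exact tsum_congr fun i => (key _ (hZ i)).symm)

theorem POVM.distr_apply (M : POVM H X) (ρ : State H) {Z : Set X} (hZ : MeasurableSet Z) :
    M.distr ρ Z = ENNReal.ofReal (tr (ρ.op * M.op Z)).re :=
  Measure.ofMeasurable_apply Z hZ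

/-- The image of an observable under a measurable map of outcomes, `A ↦ M(f⁻¹(A))`. Marginals are
images under coordinate projections. -/
def POVM.map (M : POVM H X) (f : X → Y) (hf : Measurable f) : POVM H Y where
  op A := M.op (f ⁻¹' A)
  pos A hA := M.pos _ (hf hA)
  op_univ := M.op_univ
  hasSum_iUnion Z hZ hd φ ψ := by
    rw [Set.preimage_iUnion]
    exact M.hasSum_iUnion (fun i => f ⁻¹' Z i) (fun i => hf (hZ i))
      (fun i j hij => (hd hij).preimage f) φ ψ

/-- Conjugation of a POVM by a unitary operator, `Z ↦ U⁻¹ M(Z) U`. -/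
def POVM.conj (M : POVM H X) (U : H ≃ₗᵢ[ℂ] H) : POVM H X where
  op Z := (U.symm.toContinuousLinearEquiv : H →L[ℂ] H) ∘L M.op Z ∘L
    (U.toContinuousLinearEquiv : H →L[ℂ] H)
  pos Z hZ := by
    refine ⟨fun x y => ?_, fun x => ?_⟩
    · have h := (M.pos Z hZ).isSymmetric (U x) (U y)
      have h1 := U.inner_map_map (U.symm (M.op Z (U x))) y
      have h2 := U.inner_map_map x (U.symm (M.op Z (U y)))
      simp only [LinearIsometryEquiv.apply_symm_apply] at h1 h2
      exact (h1.symm.trans h).trans h2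
    · have h := (M.pos Z hZ).re_inner_nonneg_left (U x)
      have h1 := U.inner_map_map (U.symm (M.op Z (U x))) x
      simp only [LinearIsometryEquiv.apply_symm_apply] at h1
      rw [h1] at h
      exact h
  op_univ := by
    rw [M.op_univ]
    ext x
    exact U.symm_apply_apply x
  hasSum_iUnion Z hZ hd φ ψ := by
    have h := M.hasSum_iUnion Z hZ hd (U φ) (U ψ)
    have e : ∀ W, inner ℂ (U φ) (M.op W (U ψ)) = inner ℂ φ (U.symm (M.op W (U ψ))) := by
      intro W
      have h1 := U.inner_map_map φ (U.symm (M.op W (U ψ)))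
      rwa [LinearIsometryEquiv.apply_symm_apply] at h1
    simp_rw [e] at h
    exact h

end General

/-! ### The Schrödinger representation -/

/-- Configuration space `ℝⁿ` with its Euclidean structure. -/
abbrev Conf (n : ℕ) : Type := EuclideanSpace ℝ (Fin n)

/-- The Hilbert space `L²(ℝⁿ)`. -/
abbrev Hilb (n : ℕ) : Type := Lp (α := Conf n) ℂ 2

/-- Block vectors `(x, p) ∈ ℝⁿ × ℝⁿ = ℝ²ⁿ`. -/
abbrev Phase (n : ℕ) : Type := Fin n ⊕ Fin n → ℝ

/-- The first block of a block vector. -/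
def fstBlock {n : ℕ} (z : Phase n) : Conf n := WithLp.toLp 2 fun i => z (Sum.inl i)

/-- The second block of a block vector. -/
def sndBlock {n : ℕ} (z : Phase n) : Conf n := WithLp.toLp 2 fun i => z (Sum.inr i)

variable {n : ℕ}

/-- Multiplication by a bounded measurable function on `L²(ℝⁿ)`. -/
def mulOp (g : Conf n → ℂ) (hg : MemLp g ∞ volume) : Hilb n →L[ℂ] Hilb n :=
  (ContinuousLinearMap.mul ℂ ℂ).holderL volume ∞ 2 2 hg.toLp

theorem mulOp_apply (g : Conf n → ℂ) (hg : MemLp g ∞ volume) (ψ : Hilb n) :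
    mulOp g hg ψ =ᵐ[volume] fun y => g y * ψ y := by
  have h := (ContinuousLinearMap.mul ℂ ℂ).coeFn_holder (r := 2) hg.toLp ψ
  filter_upwards [h, hg.coeFn_toLp] with y h1 h2
  change ((ContinuousLinearMap.mul ℂ ℂ).holder 2 hg.toLp ψ) y = _
  rw [h1, h2]
  rfl

/-- Translations, `(τ_x ψ)(y) = ψ(y - x)`; this is `exp (-(i/ħ) x·P)` for `P = -iħ∇`. -/
def translation (x : Conf n) : Hilb n →L[ℂ] Hilb n :=
  (Lp.compMeasurePreservingₗᵢ ℂ (fun y : Conf n => y - x)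
    (measurePreserving_sub_right volume x)).toContinuousLinearMap

theorem memLp_wave (c : ℝ) (p : Conf n) :
    MemLp (fun y : Conf n => Complex.exp (Complex.I * ((c * inner ℝ p y : ℝ) : ℂ))) ∞ volume := by
  refine memLp_top_of_bound (by fun_prop) 1 (Filter.Eventually.of_forall fun y => ?_)
  rw [mul_comm, Complex.norm_exp_ofReal_mul_I]

/-- The Weyl operators
`W(x, p) = exp {(i/ħ)(p·Q - x·P)} = exp {(i/ħ) p·Q} exp {-(i/ħ) x·P} exp {-(i/2ħ) x·p}`,
that is, `(W(x, p) ψ)(y) = exp {(i/ħ) p·y - (i/2ħ) x·p} ψ(y - x)`. -/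
def weyl (hbar : ℝ) (z : Phase n) : Hilb n →L[ℂ] Hilb n :=
  Complex.exp (-(Complex.I * ((inner ℝ (fstBlock z) (sndBlock z) / (2 * hbar) : ℝ) : ℂ))) •
    (mulOp _ (memLp_wave hbar⁻¹ (sndBlock z)) ∘L translation (fstBlock z))

theorem memLp_indicator {A : Set (Conf n)} (hA : MeasurableSet A) :
    MemLp (A.indicator fun _ => (1 : ℂ)) ∞ volume := by
  refine memLp_top_of_bound
    ((measurable_const.indicator hA).aestronglyMeasurable) 1 (Filter.Eventually.of_forall fun y => ?_)
  by_cases h : y ∈ A <;> simp [h]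

open Classical in
/-- The projection `1_A(Q)`: multiplication by the indicator of a measurable set `A`. -/
def indicatorOp (A : Set (Conf n)) : Hilb n →L[ℂ] Hilb n :=
  if hA : MeasurableSet A then mulOp _ (memLp_indicator hA) else 0

theorem inner_indicatorOp {A : Set (Conf n)} (hA : MeasurableSet A) (φ ψ : Hilb n) :
    inner ℂ φ (indicatorOp A ψ) = ∫ y in A, inner ℂ (φ y) (ψ y) := by
  rw [indicatorOp, dif_pos hA, L2.inner_def, ← integral_indicator hA]
  refine integral_congr_ae ?_
  filter_upwards [mulOp_apply _ (memLp_indicator hA) ψ] with y hy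
  rw [hy]
  by_cases h : y ∈ A <;> simp [h]

/-- The spectral measure of the vector position operator `Q`. -/
def positionPVM (n : ℕ) : POVM (Hilb n) (Conf n) where
  op A := indicatorOp A
  pos A hA := by
    refine ⟨fun φ ψ => ?_, fun φ => ?_⟩
    · change inner ℂ (indicatorOp A φ) ψ = inner ℂ φ (indicatorOp A ψ)
      rw [inner_indicatorOp hA, ← inner_conj_symm, inner_indicatorOp hA, ← integral_conj]
      simp_rw [inner_conj_symm]
    · change 0 ≤ RCLike.re (inner ℂ (indicatorOp A φ) φ)
      rw [← inner_conj_symm, RCLike.conj_re, inner_indicatorOp hA]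
      have h := integral_re (L2.integrable_inner (𝕜 := ℂ) φ φ).integrableOn (μ := volume.restrict A)
      rw [← h]
      exact integral_nonneg fun y => inner_self_nonneg
  op_univ := by
    ext1 ψ
    refine ext_inner_left ℂ fun φ => ?_
    rw [inner_indicatorOp MeasurableSet.univ, setIntegral_univ]
    rfl
  hasSum_iUnion Z hZ hd φ ψ := by
    simp_rw [inner_indicatorOp (hZ _), inner_indicatorOp (MeasurableSet.iUnion hZ)]
    exact hasSum_integral_iUnion hZ hd (L2.integrable_inner (𝕜 := ℂ) φ ψ).integrableOn

/-- The spectral measure of the vector momentum operator `P = -iħ∇`. With the Fourier transform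
`(𝓕 ψ)(ξ) = ∫ exp (-2πi ξ·y) ψ(y) dy`, the operator `P` is `𝓕⁻¹ (2πħ ξ) 𝓕`. -/
def momentumPVM (hbar : ℝ) (n : ℕ) : POVM (Hilb n) (Conf n) :=
  ((positionPVM n).map (fun ξ => (2 * Real.pi * hbar) • ξ) (by fun_prop)).conj
    (Lp.fourierTransformₗᵢ (Conf n) ℂ)

/-- The spectral measure of the position component `Q_u = u·Q`. -/
def posAlong (u : Conf n) : POVM (Hilb n) ℝ :=
  (positionPVM n).map (fun x => inner ℝ u x) (by fun_prop)

/-- The spectral measure of the momentum component `P_v = v·P`. -/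
def momAlong (hbar : ℝ) (v : Conf n) : POVM (Hilb n) ℝ :=
  (momentumPVM hbar n).map (fun p => inner ℝ v p) (by fun_prop)

/-! ### Gaussian states and Gaussian covariant bi-observables -/

/-- The matrix `Ω` with blocks `0, ħ1, -ħ1, 0`. -/
def Omega (hbar : ℝ) (n : ℕ) : Matrix (Fin n ⊕ Fin n) (Fin n ⊕ Fin n) ℝ :=
  Matrix.fromBlocks 0 (hbar • 1) (-(hbar • 1)) 0

/-- The characteristic function `w ↦ Tr (ρ W(-Ω w))` of a state. -/
def State.charFn (hbar : ℝ) (ρ : State (Hilb n)) (w : Phase n) : ℂ :=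
  tr (ρ.op * weyl hbar (-(Omega hbar n *ᵥ w)))

/-- The Gaussian function `exp {i w·μ - (1/2) w·Vw}`. -/
def gaussFn {ι : Type*} [Fintype ι] (μ : ι → ℝ) (V : Matrix ι ι ℝ) (w : ι → ℝ) : ℂ :=
  Complex.exp (Complex.I * ((w ⬝ᵥ μ : ℝ) : ℂ) - ((w ⬝ᵥ (V *ᵥ w) : ℝ) : ℂ) / 2)

/-- Gaussian states: `ρ̂(w) = exp {i w·μ - (1/2) w·Vw}` with `V` real symmetric and
`V + (i/2) Ω ≥ 0`. -/
def State.IsGaussian (hbar : ℝ) (ρ : State (Hilb n)) : Prop :=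
  ∃ (μ : Phase n) (V : Matrix (Fin n ⊕ Fin n) (Fin n ⊕ Fin n) ℝ),
    V.IsSymm ∧
    (V.map Complex.ofReal + (Complex.I / 2) • (Omega hbar n).map Complex.ofReal).PosSemidef ∧
    ∀ w, ρ.charFn hbar w = gaussFn μ V w

/-- A bi-observable `M` on `ℝᵐ × ℝᵐ` is Gaussian with parameters `(μ, V, J)`: its characteristic
function `∫ exp {i w·z} M(dz)` (a weak integral) is `W(-Ω Jᵀ w) exp {i w·μ - (1/2) w·Vw}`, where
`V` is real symmetric and `V ± (i/2) J Ω Jᵀ ≥ 0`. -/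
structure IsGaussianBiobs (hbar : ℝ) {m : ℕ} (M : POVM (Hilb n) (Phase m)) (μ : Phase m)
    (V : Matrix (Fin m ⊕ Fin m) (Fin m ⊕ Fin m) ℝ)
    (J : Matrix (Fin m ⊕ Fin m) (Fin n ⊕ Fin n) ℝ) : Prop where
  symm : V.IsSymm
  posSemidef_add : (V.map Complex.ofReal +
    (Complex.I / 2) • (J * Omega hbar n * Jᵀ).map Complex.ofReal).PosSemidef
  posSemidef_sub : (V.map Complex.ofReal -
    (Complex.I / 2) • (J * Omega hbar n * Jᵀ).map Complex.ofReal).PosSemidef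
  charFn_eq : ∀ (w : Phase m) (ψ : Hilb n),
    ∫ z, Complex.exp (Complex.I * ((w ⬝ᵥ z : ℝ) : ℂ)) ∂(M.scalarMeasure ψ) =
      inner ℂ ψ ((gaussFn μ V w • weyl hbar (-(Omega hbar n *ᵥ (Jᵀ *ᵥ w)))) ψ)

/-- The point `(x, p)` of `ℝ × ℝ`. -/
def pair (x p : ℝ) : Phase 1 := Sum.elim (fun _ => x) (fun _ => p)

/-- `(u, v)`-covariance: `W(x, p) M(Z) W(x, p)* = M(Z + (u·x, v·p))`. -/
def IsCovariant (hbar : ℝ) (u v : Conf n) (M : POVM (Hilb n) (Phase 1)) : Prop :=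
  ∀ (z : Phase n) (Z : Set (Phase 1)), MeasurableSet Z →
    weyl hbar z ∘L M.op Z ∘L ContinuousLinearMap.adjoint (weyl hbar z) =
      M.op ((fun y => y + pair (inner ℝ u (fstBlock z)) (inner ℝ v (sndBlock z))) '' Z)

/-- The first (position) marginal. -/
def fstMarginal (M : POVM (Hilb n) (Phase 1)) : POVM (Hilb n) ℝ :=
  M.map (fun z => z (Sum.inl 0)) (by fun_prop)

/-- The second (momentum) marginal. -/
def sndMarginal (M : POVM (Hilb n) (Phase 1)) : POVM (Hilb n) ℝ :=
  M.map (fun z => z (Sum.inr 0)) (by fun_prop)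

/-! ### Entropic error function and divergence -/

/-- Relative entropy in bits, with values in `[0, ∞]`. -/
def relEntropy (p q : Measure ℝ) : ℝ≥0∞ :=
  InformationTheory.klDiv p q / ENNReal.ofReal (Real.log 2)

/-- `Var(Q_{u,ρ})`. -/
def varPos (u : Conf n) (ρ : State (Hilb n)) : ℝ := Var[id; (posAlong u).distr ρ]

/-- `Var(P_{v,ρ})`. -/
def varMom (hbar : ℝ) (v : Conf n) (ρ : State (Hilb n)) : ℝ := Var[id; (momAlong hbar v).distr ρ]

/-- The error function `S(ρ, M) = S(Q_{u,ρ} ‖ M_{1,ρ}) + S(P_{v,ρ} ‖ M_{2,ρ})`. -/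
def errorFn (hbar : ℝ) (u v : Conf n) (ρ : State (Hilb n)) (M : POVM (Hilb n) (Phase 1)) : ℝ≥0∞ :=
  relEntropy ((posAlong u).distr ρ) ((fstMarginal M).distr ρ) +
    relEntropy ((momAlong hbar v).distr ρ) ((sndMarginal M).distr ρ)

/-- Gaussian states with `Var(Q_{u,ρ}) ≥ ε₁` and `Var(P_{v,ρ}) ≥ ε₂`. -/
def gaussianStatesAbove (hbar : ℝ) (u v : Conf n) (ε₁ ε₂ : ℝ) : Set (State (Hilb n)) :=
  {ρ | ρ.IsGaussian hbar ∧ ε₁ ≤ varPos u ρ ∧ ε₂ ≤ varMom hbar v ρ}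

/-- The Gaussian `ε`-entropic divergence `sup_ρ S(ρ, M)` of `Q_u, P_v` from `M`. -/
def divergence (hbar : ℝ) (u v : Conf n) (ε₁ ε₂ : ℝ) (M : POVM (Hilb n) (Phase 1)) : ℝ≥0∞ :=
  ⨆ ρ ∈ gaussianStatesAbove hbar u v ε₁ ε₂, errorFn hbar u v ρ M

/-- `s(x) = ln (1 + x) - x / (1 + x)`. -/
def sFn (x : ℝ) : ℝ := Real.log (1 + x) - x / (1 + x)

/-- `((log₂ e)/2) [s(V₁₁/c₁) + s(V₂₂/c₂) + a²/(V₁₁ + c₁) + b²/(V₂₂ + c₂)]`, where `μ = (a, b)` and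
`c₁`, `c₂` are the variances of the target distributions. -/
def gaussianError (μ : Phase 1) (V : Matrix (Fin 1 ⊕ Fin 1) (Fin 1 ⊕ Fin 1) ℝ) (c₁ c₂ : ℝ) : ℝ :=
  Real.logb 2 (Real.exp 1) / 2 *
    (sFn (V (Sum.inl 0) (Sum.inl 0) / c₁) + sFn (V (Sum.inr 0) (Sum.inr 0) / c₂) +
      (μ (Sum.inl 0) ^ 2 / (V (Sum.inl 0) (Sum.inl 0) + c₁) +
        μ (Sum.inr 0) ^ 2 / (V (Sum.inr 0) (Sum.inr 0) + c₂)))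

end QM

end

namespace QM

/-! ### Outcome distributions as sums over vector states -/

section General

variable {H : Type*} [NormedAddCommGroup H] [InnerProductSpace ℂ H]
variable {X Y : Type*} [MeasurableSpace X] [MeasurableSpace Y]

/-! The error function of a Gaussian state depends only on the two target variances and decreases in
each of them, so the supremum is reached at the smallest admissible variances as soon as some
Gaussian state has both.

Reduction to variances. The unitaries exp(it u·Q) and exp(it v·P) are the Weyl operators W(-Ωw) with
w = t(u,0) and w = t(0,v), so the characteristic functions of the target distributions are
restrictions of the one of ρ to two lines (`charFun_posAlong_distr`, `charFun_momAlong_distr`).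
Covariance forces Jᵀw = (w₁u, w₂v) (`IsGaussianBiobs.transpose_mulVec`). Hence each marginal of M in
ρ is the corresponding target convolved with a fixed Gaussian noise, of mean a or b and variance V₁₁
or V₂₂. Everything is then Gaussian on the line, and the relative entropies are explicit
(`errorFn_eq_gaussianError`). Monotonicity is that of s together with that of c ↦ a²/(V₁₁ + c)
(`gaussianError_anti`).

Existence. In the pure state with wave function proportional to exp(-|Ay|²/2 + ib|y|²/2), with D the
inverse transpose of A, the variances are |Du|²/2 for u·Q and ħ²(|Av|² + b²|Dv|²)/2 for v·P. A
rank-one perturbation of a multiple of the identity (`exists_shear`) gives Du the prescribed length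
while keeping |Av| small enough exactly under the hypothesis ε₁ε₂ ≥ (ħ²/4)cos²α, and the chirp b
then raises the momentum variance to the desired value. The uncertainty relation itself is never
needed: in case (ii) only a lower bound for the supremum is claimed. -/

instance POVM.isFiniteMeasure_scalarMeasure (M : POVM H X) (ψ : H) :
    IsFiniteMeasure (M.scalarMeasure ψ) :=
  ⟨by rw [M.scalarMeasure_apply ψ MeasurableSet.univ]; exact ENNReal.ofReal_lt_top⟩

theorem POVM.scalarMeasure_map (M : POVM H X) (f : X → Y) (hf : Measurable f) (ψ : H) :
    (M.map f hf).scalarMeasure ψ = (M.scalarMeasure ψ).map f := by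
  ext Z hZ
  rw [Measure.map_apply hf hZ, POVM.scalarMeasure_apply _ _ hZ,
    POVM.scalarMeasure_apply _ _ (hf hZ)]
  rfl

theorem POVM.scalarMeasure_conj (M : POVM H X) (U : H ≃ₗᵢ[ℂ] H) (ψ : H) :
    (M.conj U).scalarMeasure ψ = M.scalarMeasure (U ψ) := by
  ext Z hZ
  rw [POVM.scalarMeasure_apply _ _ hZ, POVM.scalarMeasure_apply _ _ hZ]
  have h : inner ℂ (U ψ) (U (U.symm (M.op Z (U ψ)))) = inner ℂ ψ (U.symm (M.op Z (U ψ))) :=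
    U.inner_map_map ψ _
  rw [LinearIsometryEquiv.apply_symm_apply] at h
  rw [h]
  rfl

variable [CompleteSpace H]

/-- Since Tr(ρT) = ∑ⱼ ⟨√ρ eⱼ, T √ρ eⱼ⟩, a mixed state acts as a sum of unnormalized vector states.
Identities between integrals and operators therefore need checking only on vectors. -/
theorem POVM.distr_eq_sum (M : POVM H X) (ρ : State H) :
    M.distr ρ = Measure.sum fun j => M.scalarMeasure (CFC.sqrt ρ.op (basis H j)) := by
  ext Z hZ
  rw [M.distr_apply ρ hZ, Measure.sum_apply _ hZ]
  have h := Complex.hasSum_re (hasSum_tr ρ (M.op Z))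
  rw [← h.tsum_eq, ENNReal.ofReal_tsum_of_nonneg
    (fun i => re_inner_nonneg (M.pos Z hZ) _) h.summable]
  exact tsum_congr fun j => (M.scalarMeasure_apply _ hZ).symm

instance POVM.isProbabilityMeasure_distr (M : POVM H X) (ρ : State H) :
    IsProbabilityMeasure (M.distr ρ) :=
  ⟨by
    rw [M.distr_apply ρ MeasurableSet.univ, M.op_univ, mul_one, tr, ρ.trace_one.tsum_eq]
    simp⟩

/-- Operator integrals of bounded functions against an observable give expectation values. -/
theorem POVM.integral_distr (M : POVM H X) (ρ : State H) (T : H →L[ℂ] H) {F : X → ℂ}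
    (hF : Integrable F (M.distr ρ))
    (hT : ∀ ψ, ∫ x, F x ∂(M.scalarMeasure ψ) = inner ℂ ψ (T ψ)) :
    ∫ x, F x ∂(M.distr ρ) = tr (ρ.op * T) := by
  have h1 : HasSum (fun j => ∫ x, F x ∂(M.scalarMeasure (CFC.sqrt ρ.op (basis H j))))
      (∫ x, F x ∂(M.distr ρ)) := by
    rw [M.distr_eq_sum ρ] at hF ⊢
    exact hasSum_integral_measure hF
  simp_rw [hT] at h1
  exact h1.unique (hasSum_tr ρ T)

theorem POVM.charFun_distr (M : POVM H ℝ) (ρ : State H) (T : H →L[ℂ] H) (t : ℝ)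
    (hT : ∀ ψ, charFun (M.scalarMeasure ψ) t = inner ℂ ψ (T ψ)) :
    charFun (M.distr ρ) t = tr (ρ.op * T) := by
  simp_rw [charFun_apply] at hT ⊢
  refine M.integral_distr ρ T ?_ hT
  refine Integrable.of_bound (C := 1) (by fun_prop) (Filter.Eventually.of_forall fun x => ?_)
  rw [Complex.norm_exp_ofReal_mul_I]

end General

variable {n : ℕ}

/-! ### Position, momentum and Weyl operators -/

theorem scalarMeasure_positionPVM (ψ : Hilb n) :
    (positionPVM n).scalarMeasure ψ = volume.withDensity fun y => ENNReal.ofReal (‖ψ y‖ ^ 2) := by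
  ext Z hZ
  rw [POVM.scalarMeasure_apply _ _ hZ, withDensity_apply _ hZ]
  have hint := (L2.integrable_inner (𝕜 := ℂ) ψ ψ).integrableOn (μ := volume) (s := Z)
  have e : ∀ y, ‖ψ y‖ ^ 2 = RCLike.re (inner ℂ (ψ y) (ψ y)) := fun y =>
    (inner_self_eq_norm_sq (𝕜 := ℂ) (ψ y)).symm
  simp_rw [e]
  rw [← ofReal_integral_eq_lintegral_ofReal hint.re
    (Filter.Eventually.of_forall fun y => inner_self_nonneg), integral_re hint]
  congr 2
  exact inner_indicatorOp hZ ψ ψ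

theorem integral_scalarMeasure_positionPVM (g : Conf n → ℂ) (hg : MemLp g ∞ volume) (ψ : Hilb n) :
    ∫ y, g y ∂((positionPVM n).scalarMeasure ψ) = inner ℂ ψ (mulOp g hg ψ) := by
  have hm : Measurable fun y => ENNReal.ofReal (‖ψ y‖ ^ 2) :=
    ((Lp.stronglyMeasurable ψ).measurable.norm.pow_const 2).ennreal_ofReal
  rw [scalarMeasure_positionPVM, integral_withDensity_eq_integral_toReal_smul hm
    (Filter.Eventually.of_forall fun y => ENNReal.ofReal_lt_top), L2.inner_def]
  refine integral_congr_ae ?_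
  filter_upwards [mulOp_apply g hg ψ] with y hy
  rw [hy, ENNReal.toReal_ofReal (sq_nonneg _), RCLike.inner_apply, mul_assoc, Complex.mul_conj,
    Complex.normSq_eq_norm_sq, Complex.real_smul, mul_comm]

theorem translation_apply (x : Conf n) (ψ : Hilb n) :
    translation x ψ =ᵐ[volume] fun y => ψ (y - x) :=
  Lp.coeFn_compMeasurePreserving ψ (measurePreserving_sub_right volume x)

theorem weyl_apply (hbar : ℝ) (z : Phase n) (ψ : Hilb n) :
    weyl hbar z ψ =ᵐ[volume] fun y => Complex.exp (Complex.I *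
      ((hbar⁻¹ * inner ℝ (sndBlock z) y
        - inner ℝ (fstBlock z) (sndBlock z) / (2 * hbar) : ℝ) : ℂ)) * ψ (y - fstBlock z) := by
  have h1 := mulOp_apply _ (memLp_wave hbar⁻¹ (sndBlock z)) (translation (fstBlock z) ψ)
  have h2 := translation_apply (fstBlock z) ψ
  have h3 := Lp.coeFn_smul
    (Complex.exp (-(Complex.I * ((inner ℝ (fstBlock z) (sndBlock z) / (2 * hbar) : ℝ) : ℂ))))
    (mulOp _ (memLp_wave hbar⁻¹ (sndBlock z)) (translation (fstBlock z) ψ))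
  filter_upwards [h1, h2, h3] with y e1 e2 e3
  change (Complex.exp _ • mulOp _ (memLp_wave hbar⁻¹ (sndBlock z)) (translation (fstBlock z) ψ)) y
    = _
  rw [e3, Pi.smul_apply, e1, e2, smul_eq_mul, ← mul_assoc, ← Complex.exp_add]
  congr 2
  push_cast
  ring

theorem fstBlock_neg_Omega (hbar : ℝ) (w : Phase n) :
    fstBlock (-(Omega hbar n *ᵥ w)) = -(hbar • sndBlock w) := by
  ext i
  simp [fstBlock, sndBlock, Omega, Matrix.fromBlocks_mulVec, Matrix.smul_mulVec]

theorem sndBlock_neg_Omega (hbar : ℝ) (w : Phase n) :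
    sndBlock (-(Omega hbar n *ᵥ w)) = hbar • fstBlock w := by
  ext i
  simp [fstBlock, sndBlock, Omega, Matrix.fromBlocks_mulVec, Matrix.smul_mulVec, Matrix.neg_mulVec]

/-- The block vector with blocks `x` and `p`. -/
def blocks (x p : Conf n) : Phase n := Sum.elim (fun i => x i) fun i => p i

@[simp] theorem fstBlock_blocks (x p : Conf n) : fstBlock (blocks x p) = x := by
  ext i; simp [fstBlock, blocks]

@[simp] theorem sndBlock_blocks (x p : Conf n) : sndBlock (blocks x p) = p := by
  ext i; simp [sndBlock, blocks]

theorem blocks_eta (z : Phase n) : blocks (fstBlock z) (sndBlock z) = z := by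
  ext (i | i) <;> simp [fstBlock, sndBlock, blocks]

theorem smul_blocks (t : ℝ) (x p : Conf n) : t • blocks x p = blocks (t • x) (t • p) := by
  ext (i | i) <;> simp [blocks]

/-- Both sides are continuous in ψ, so Schwartz functions suffice; there it is a change of variable
in the Fourier integral. This is what connects the spectral measure of momentum with the
translations inside the Weyl operators. -/
theorem fourier_translation (x : Conf n) (ψ : Hilb n) :
    Lp.fourierTransformₗᵢ (Conf n) ℂ (translation x ψ) =
      mulOp _ (memLp_wave (-(2 * Real.pi)) x) (Lp.fourierTransformₗᵢ (Conf n) ℂ ψ) := by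
  refine DenseRange.induction_on (p := fun ψ : Hilb n =>
    Lp.fourierTransformₗᵢ (Conf n) ℂ (translation x ψ) =
      mulOp _ (memLp_wave (-(2 * Real.pi)) x) (Lp.fourierTransformₗᵢ (Conf n) ℂ ψ))
    (SchwartzMap.denseRange_toLpCLM (p := 2) (μ := (volume : Measure (Conf n)))
      ENNReal.ofNat_ne_top) ψ (isClosed_eq (by fun_prop) (by fun_prop)) fun f => ?_
  change Lp.fourierTransformₗᵢ (Conf n) ℂ (translation x (f.toLp 2)) =
    mulOp _ (memLp_wave (-(2 * Real.pi)) x) (Lp.fourierTransformₗᵢ (Conf n) ℂ (f.toLp 2))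
  have e : translation x (f.toLp 2) = (f.compSubConstCLM ℂ x).toLp 2 := by
    refine Lp.ext ?_
    have h1 := (measurePreserving_sub_right volume x).quasiMeasurePreserving.ae_eq_comp
      (f.coeFn_toLp 2 (volume : Measure (Conf n)))
    filter_upwards [translation_apply x (f.toLp 2), h1,
      (f.compSubConstCLM ℂ x).coeFn_toLp 2 (volume : Measure (Conf n))] with y e1 e2 e3
    rw [e1, e3]
    exact e2
  rw [e]
  have h1 := SchwartzMap.toLp_fourier_eq (f.compSubConstCLM ℂ x)
  have h2 := SchwartzMap.toLp_fourier_eq f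
  change Lp.fourierTransformₗᵢ (Conf n) ℂ _ = _ at h1 h2
  rw [h1, h2]
  refine Lp.ext ?_
  filter_upwards [mulOp_apply _ (memLp_wave (-(2 * Real.pi)) x)
      ((FourierTransform.fourier f : SchwartzMap (Conf n) ℂ).toLp 2),
    (FourierTransform.fourier f : SchwartzMap (Conf n) ℂ).coeFn_toLp 2
      (volume : Measure (Conf n)),
    (FourierTransform.fourier (f.compSubConstCLM ℂ x) : SchwartzMap (Conf n) ℂ).coeFn_toLp 2
      (volume : Measure (Conf n))] with ξ e1 e2 e3
  rw [e1, e2, e3, SchwartzMap.fourier_coe, SchwartzMap.fourier_coe, Real.fourier_eq',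
    Real.fourier_eq', ← integral_const_mul,
    ← integral_sub_right_eq_self (fun y => _ * _) x]
  refine integral_congr_ae (Filter.Eventually.of_forall fun y => ?_)
  simp only [smul_eq_mul, SchwartzMap.compSubConstCLM_apply]
  rw [← mul_assoc, ← Complex.exp_add]
  congr 2
  rw [inner_sub_left]
  push_cast
  ring

/-- Here -Ω(tu, 0) = (0, ħtu), whose Weyl operator is multiplication by exp(it u·y). -/
theorem charFun_posAlong_distr {hbar : ℝ} (hh : 0 < hbar) (u : Conf n) (ρ : State (Hilb n))
    (t : ℝ) : charFun ((posAlong u).distr ρ) t = ρ.charFn hbar (t • blocks u 0) := by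
  refine POVM.charFun_distr _ ρ _ t fun ψ => ?_
  rw [posAlong, POVM.scalarMeasure_map, charFun_apply, integral_map (by fun_prop) (by fun_prop)]
  have h := integral_scalarMeasure_positionPVM _ (memLp_wave t u) ψ
  have e : weyl hbar (-(Omega hbar n *ᵥ (t • blocks u 0))) ψ = mulOp _ (memLp_wave t u) ψ := by
    refine Lp.ext ?_
    filter_upwards [weyl_apply hbar (-(Omega hbar n *ᵥ (t • blocks u 0))) ψ,
      mulOp_apply _ (memLp_wave t u) ψ] with y e1 e2
    rw [e1, e2, fstBlock_neg_Omega, sndBlock_neg_Omega, smul_blocks, fstBlock_blocks,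
      sndBlock_blocks]
    simp only [smul_zero, neg_zero, inner_zero_left, sub_zero, zero_div, inner_smul_left]
    congr 4
    simp
    field_simp
  rw [e, ← h]
  refine integral_congr_ae (Filter.Eventually.of_forall fun y => ?_)
  simp only
  rw [mul_comm]
  congr 3

/-- Here -Ω(0, tv) = (-ħtv, 0), whose Weyl operator is a pure translation; the Fourier transform
turns it into multiplication by exp(2πiħt v·ξ). -/
theorem charFun_momAlong_distr (hbar : ℝ) (v : Conf n) (ρ : State (Hilb n))
    (t : ℝ) : charFun ((momAlong hbar v).distr ρ) t = ρ.charFn hbar (t • blocks 0 v) := by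
  refine POVM.charFun_distr _ ρ _ t fun ψ => ?_
  rw [momAlong, momentumPVM, POVM.scalarMeasure_map, POVM.scalarMeasure_conj,
    POVM.scalarMeasure_map, charFun_apply, integral_map (by fun_prop) (by fun_prop),
    integral_map (by fun_prop) (by fun_prop)]
  have h := integral_scalarMeasure_positionPVM _
    (memLp_wave (-(2 * Real.pi)) (-(hbar • (t • v)))) (Lp.fourierTransformₗᵢ (Conf n) ℂ ψ)
  rw [← fourier_translation, LinearIsometryEquiv.inner_map_map] at h
  have e : weyl hbar (-(Omega hbar n *ᵥ (t • blocks 0 v))) ψ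
      = translation (-(hbar • (t • v))) ψ := by
    refine Lp.ext ?_
    filter_upwards [weyl_apply hbar (-(Omega hbar n *ᵥ (t • blocks 0 v))) ψ,
      translation_apply (-(hbar • (t • v))) ψ] with y e1 e2
    rw [e1, e2, fstBlock_neg_Omega, sndBlock_neg_Omega, smul_blocks, fstBlock_blocks,
      sndBlock_blocks]
    simp
  rw [e, ← h]
  refine integral_congr_ae (Filter.Eventually.of_forall fun y => ?_)
  simp only
  rw [mul_comm]
  congr 2
  simp [inner_smul_left, inner_smul_right]
  ring

/-! ### Relative entropy of Gaussian distributions -/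

open scoped NNReal in
theorem integrable_and_integral_sq_sub_gaussianReal (m c : ℝ) (v : ℝ≥0) :
    Integrable (fun x => (x - c) ^ 2) (gaussianReal m v) ∧
      ∫ x, (x - c) ^ 2 ∂(gaussianReal m v) = v + (m - c) ^ 2 := by
  have h0 : Integrable (fun x : ℝ => x) (gaussianReal m v) :=
    (memLp_id_gaussianReal' 1 ENNReal.one_ne_top).integrable le_rfl
  have h1 : Integrable (fun x : ℝ => x - m) (gaussianReal m v) := h0.sub (integrable_const m)
  have h2 : Integrable (fun x : ℝ => (x - m) ^ 2) (gaussianReal m v) :=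
    ((memLp_id_gaussianReal' 2 ENNReal.ofNat_ne_top).sub (memLp_const m)).integrable_sq
  have e1 : ∫ x, (x - m) ∂(gaussianReal m v) = 0 := by
    rw [integral_sub h0 (integrable_const m)]
    simp
  have e2 : ∫ x, (x - m) ^ 2 ∂(gaussianReal m v) = v := by
    have h := variance_eq_integral (X := id) (μ := gaussianReal m v) aemeasurable_id
    rw [variance_id_gaussianReal] at h
    simpa using h.symm
  have e : (fun x : ℝ => (x - c) ^ 2)
      = fun x => (x - m) ^ 2 + 2 * (m - c) * (x - m) + (m - c) ^ 2 := by
    ext x; ring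
  have h3 : Integrable (fun x : ℝ => (x - m) ^ 2 + 2 * (m - c) * (x - m)) (gaussianReal m v) :=
    h2.add (h1.const_mul (2 * (m - c)))
  rw [e]
  refine ⟨h3.add (integrable_const _), ?_⟩
  rw [integral_add h3 (integrable_const _), integral_add h2 (h1.const_mul _), integral_const_mul,
    e1, e2]
  simp

open scoped NNReal in
theorem log_gaussianPDFReal (m : ℝ) {v : ℝ≥0} (hv : v ≠ 0) (x : ℝ) :
    Real.log (gaussianPDFReal m v x)
      = -(Real.log (2 * Real.pi) + Real.log v) / 2 - (x - m) ^ 2 / (2 * v) := by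
  have hv' : (0 : ℝ) < v := by positivity
  rw [gaussianPDFReal, Real.log_mul (by positivity) (by positivity), Real.log_exp, Real.log_inv,
    Real.log_sqrt (by positivity), Real.log_mul (by positivity) hv'.ne']
  ring

open scoped NNReal in
theorem klDiv_gaussianReal (m a : ℝ) {v : ℝ≥0} (hv : v ≠ 0) (d : ℝ≥0) :
    InformationTheory.klDiv (gaussianReal m v) (gaussianReal (m + a) (v + d))
      = ENNReal.ofReal ((sFn (d / v) + a ^ 2 / (d + v)) / 2) := by
  have hw : v + d ≠ 0 := by positivity
  have hv' : (0 : ℝ) < v := by positivity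
  have hd' : (0 : ℝ) ≤ d := d.2
  have hac : gaussianReal m v ≪ gaussianReal (m + a) (v + d) :=
    (gaussianReal_absolutelyContinuous m hv).trans (gaussianReal_absolutelyContinuous' _ hw)
  set f : ℝ → ℝ := fun x => (Real.log (v + d) - Real.log v) / 2 + (2 * (v + d : ℝ))⁻¹ *
    (x - (m + a)) ^ 2 - (2 * (v : ℝ))⁻¹ * (x - m) ^ 2 with hf
  have hllr : llr (gaussianReal m v) (gaussianReal (m + a) (v + d)) =ᵐ[gaussianReal m v] f := by
    refine (gaussianReal_absolutelyContinuous m hv).ae_le ?_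
    -- Chain rule through Lebesgue measure: the likelihood ratio is the quotient of the two Gaussian
    -- densities, so its logarithm is the quadratic polynomial `f`.
    filter_upwards [Measure.rnDeriv_mul_rnDeriv (κ := volume) hac, rnDeriv_gaussianReal m v,
      rnDeriv_gaussianReal (m + a) (v + d)] with x e1 e2 e3
    rw [Pi.mul_apply, e2, e3] at e1
    have e4 := congrArg ENNReal.toReal e1
    rw [ENNReal.toReal_mul, toReal_gaussianPDF, toReal_gaussianPDF] at e4
    have hp := gaussianPDFReal_pos m v x hv
    have hq := gaussianPDFReal_pos (m + a) (v + d) x hw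
    rw [llr, eq_div_of_mul_eq hq.ne' e4, Real.log_div hp.ne' hq.ne', log_gaussianPDFReal m hv,
      log_gaussianPDFReal (m + a) hw, hf]
    push_cast
    field_simp
    ring
  obtain ⟨i1, e1⟩ := integrable_and_integral_sq_sub_gaussianReal m (m + a) v
  obtain ⟨i2, e2⟩ := integrable_and_integral_sq_sub_gaussianReal m m v
  have i3 : Integrable (fun x : ℝ => (Real.log (v + d) - Real.log v) / 2 + (2 * (v + d : ℝ))⁻¹ *
      (x - (m + a)) ^ 2) (gaussianReal m v) :=
    (integrable_const _).add (i1.const_mul _)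
  have i4 := i2.const_mul (2 * (v : ℝ))⁻¹
  rw [InformationTheory.klDiv_of_ac_of_integrable hac ((i3.sub i4).congr hllr.symm),
    integral_congr_ae hllr]
  have e : ∫ x, f x ∂(gaussianReal m v) = (sFn (d / v) + a ^ 2 / (d + v)) / 2 := by
    simp only [hf]
    rw [integral_sub i3 i4, integral_add (integrable_const _) (i1.const_mul _),
      integral_const_mul, integral_const_mul, e1, e2, sFn,
      show (1 + d / v : ℝ) = (v + d) / v by field_simp, Real.log_div (by positivity) hv'.ne']
    simp
    field_simp
    ring
  rw [e]
  simp

open scoped NNReal in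
theorem relEntropy_gaussianReal (m a : ℝ) {v : ℝ≥0} (hv : v ≠ 0) (d : ℝ≥0) :
    relEntropy (gaussianReal m v) (gaussianReal (m + a) (v + d))
      = ENNReal.ofReal (Real.logb 2 (Real.exp 1) / 2 * (sFn (d / v) + a ^ 2 / (d + v))) := by
  rw [relEntropy, klDiv_gaussianReal m a hv d, ← ENNReal.ofReal_div_of_pos (Real.log_pos one_lt_two),
    Real.logb, Real.log_exp]
  congr 1
  ring

theorem sFn_nonneg {x : ℝ} (hx : 0 ≤ x) : 0 ≤ sFn x := by
  have h := Real.one_sub_inv_le_log_of_pos (show 0 < 1 + x by linarith)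
  have e : 1 - (1 + x)⁻¹ = x / (1 + x) := by field_simp; ring
  rw [sFn]
  linarith

theorem sFn_mono {x y : ℝ} (hx : 0 ≤ x) (hxy : x ≤ y) : sFn x ≤ sFn y := by
  have hx1 : 0 < 1 + x := by linarith
  have hy1 : 0 < 1 + y := by linarith
  -- The bound ln r ≥ 1 - 1/r at r = (1+y)/(1+x) already exceeds the increment of x/(1+x), by the
  -- nonnegative quantity in `e`.
  have h := Real.one_sub_inv_le_log_of_pos (show 0 < (1 + y) / (1 + x) by positivity)
  rw [Real.log_div hy1.ne' hx1.ne'] at h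
  have e : 1 - ((1 + y) / (1 + x))⁻¹ - (y / (1 + y) - x / (1 + x))
      = (y - x) * x / ((1 + x) * (1 + y)) := by
    field_simp
    ring
  have h2 : 0 ≤ (y - x) * x / ((1 + x) * (1 + y)) := by
    have := sub_nonneg.2 hxy
    positivity
  rw [sFn, sFn]
  linarith

theorem logb_exp_nonneg : 0 ≤ Real.logb 2 (Real.exp 1) / 2 := by
  have := Real.logb_nonneg one_lt_two (Real.one_le_exp zero_le_one)
  positivity

theorem gaussianError_anti (μ : Phase 1) {V : Matrix (Fin 1 ⊕ Fin 1) (Fin 1 ⊕ Fin 1) ℝ}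
    (h1 : 0 ≤ V (Sum.inl 0) (Sum.inl 0)) (h2 : 0 ≤ V (Sum.inr 0) (Sum.inr 0)) {c₁ c₂ d₁ d₂ : ℝ}
    (hc₁ : 0 < c₁) (hc₂ : 0 < c₂) (hd₁ : c₁ ≤ d₁) (hd₂ : c₂ ≤ d₂) :
    gaussianError μ V d₁ d₂ ≤ gaussianError μ V c₁ c₂ := by
  have hd₁' := hc₁.trans_le hd₁
  have hd₂' := hc₂.trans_le hd₂
  refine mul_le_mul_of_nonneg_left ?_ logb_exp_nonneg
  gcongr ?_ + ?_ + (?_ + ?_)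
  · exact sFn_mono (by positivity) (by gcongr)
  · exact sFn_mono (by positivity) (by gcongr)
  · gcongr
  · gcongr

/-! ### Pure states -/

section Pure

variable {H : Type*} [NormedAddCommGroup H] [InnerProductSpace ℂ H] [CompleteSpace H]

/-- The pure state `|ψ⟩⟨ψ|` of a unit vector. -/
noncomputable def pureState (ψ : H) (hψ : ‖ψ‖ = 1) : State H where
  op := InnerProductSpace.rankOne ℂ ψ ψ
  pos := InnerProductSpace.isPositive_rankOne_self ψ
  trace_one := by
    have h := (basis H).hasSum_inner_mul_inner ψ ψ
    rw [inner_self_eq_norm_sq_to_K, hψ] at h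
    convert! h using 2 with i
    · simp
    · simp

theorem tr_pureState_mul (ψ : H) (hψ : ‖ψ‖ = 1) (T : H →L[ℂ] H) :
    tr ((pureState ψ hψ).op * T) = inner ℂ ψ (T ψ) := by
  have h := (basis H).hasSum_inner_mul_inner (ContinuousLinearMap.adjoint T ψ) ψ
  rw [ContinuousLinearMap.adjoint_inner_left] at h
  rw [tr, ← h.tsum_eq]
  refine tsum_congr fun i => ?_
  simp [pureState, ContinuousLinearMap.adjoint_inner_left]

end Pure

/-! ### Gaussian wave functions -/

/-- The chirped Gaussian `y ↦ exp {-(1/2) |A y|² + (i b/2) |y|²}`. -/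
noncomputable def gaussWave (A : Conf n →L[ℝ] Conf n) (b : ℝ) (y : Conf n) : ℂ :=
  Complex.exp (((-‖A y‖ ^ 2 / 2 : ℝ) : ℂ) + Complex.I * ((b * ‖y‖ ^ 2 / 2 : ℝ) : ℂ))

theorem continuous_gaussWave (A : Conf n →L[ℝ] Conf n) (b : ℝ) : Continuous (gaussWave A b) := by
  unfold gaussWave
  fun_prop

theorem norm_gaussWave_sq (A : Conf n →L[ℝ] Conf n) (b : ℝ) (y : Conf n) :
    ‖gaussWave A b y‖ ^ 2 = Real.exp (-‖A y‖ ^ 2) := by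
  rw [gaussWave, Complex.norm_exp, ← Real.exp_nat_mul]
  congr 1
  simp [-Complex.ofReal_pow]
  ring

/-- The factor is |det A|⁻¹; only its being nonzero and finite matters, since normalization of the
wave function removes it. -/
theorem exists_map_volume_eq_smul (A : Conf n ≃L[ℝ] Conf n) :
    ∃ c : ℝ≥0∞, c ≠ 0 ∧ c ≠ ∞ ∧ Measure.map A (volume : Measure (Conf n)) = c • volume := by
  have hdet : LinearMap.det ((A : Conf n →L[ℝ] Conf n) : Conf n →ₗ[ℝ] Conf n) ≠ 0 :=
    (LinearEquiv.isUnit_det' A.toLinearEquiv).ne_zero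
  refine ⟨_, ?_, ENNReal.ofReal_ne_top, Measure.map_linearMap_addHaar_eq_smul_addHaar volume hdet⟩
  rw [ne_eq, ENNReal.ofReal_eq_zero, not_le, abs_pos]
  exact inv_ne_zero hdet

theorem memLp_gaussWave (A : Conf n ≃L[ℝ] Conf n) (b : ℝ) :
    MemLp (gaussWave (A : Conf n →L[ℝ] Conf n) b) 2 volume := by
  refine (memLp_two_iff_integrable_sq_norm
    (continuous_gaussWave _ b).aestronglyMeasurable).2 ?_
  simp_rw [norm_gaussWave_sq]
  obtain ⟨c, -, hc, hmap⟩ := exists_map_volume_eq_smul A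
  have h1 : Integrable (fun z : Conf n => Real.exp (-‖z‖ ^ 2)) volume := by
    have h := (GaussianFourier.integrable_cexp_neg_mul_sq_norm_add (V := Conf n) (b := 1)
      (by simp) 0 0).norm
    refine h.congr (Filter.Eventually.of_forall fun z => ?_)
    simp only [Complex.norm_exp]
    congr 1
    simp [← Complex.ofReal_pow]
  have h2 := h1.smul_measure hc
  rw [← hmap] at h2
  exact (integrable_map_measure (by fun_prop) A.continuous.aemeasurable).1 h2

/-- The hypothesis makes D the inverse transpose of A, so the substitution z = Ay turns q·y into
Dq·z and leaves a standard Gaussian Fourier integral. -/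
theorem exists_integral_gaussian (A : Conf n ≃L[ℝ] Conf n) (D : Conf n →L[ℝ] Conf n)
    (hD : ∀ q z, inner ℝ (D q) (A z) = inner ℝ q z) :
    ∃ K : ℂ, K ≠ 0 ∧ ∀ q : Conf n,
      ∫ y, Complex.exp (((-‖A y‖ ^ 2 : ℝ) : ℂ) + Complex.I * ((inner ℝ q y : ℝ) : ℂ)) =
        K * Complex.exp ((-‖D q‖ ^ 2 / 4 : ℝ) : ℂ) := by
  obtain ⟨c, hc0, hc, hmap⟩ := exists_map_volume_eq_smul A
  refine ⟨(c.toReal : ℂ) * (Real.pi / 1 : ℂ) ^ (Module.finrank ℝ (Conf n) / 2 : ℂ), ?_, fun q => ?_⟩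
  · refine mul_ne_zero ?_ ?_
    · exact_mod_cast (ENNReal.toReal_pos hc0 hc).ne'
    · rw [ne_eq, Complex.cpow_eq_zero_iff]
      simp [Real.pi_ne_zero]
  · have h := GaussianFourier.integral_cexp_neg_mul_sq_norm_add (V := Conf n) (b := 1)
      (by simp) Complex.I (D q)
    have h2 := integral_smul_measure (μ := (volume : Measure (Conf n)))
      (fun z => Complex.exp (-1 * (‖z‖ : ℂ) ^ 2 + Complex.I * ((inner ℝ (D q) z : ℝ) : ℂ))) c
    rw [← hmap, integral_map A.continuous.aemeasurable (by fun_prop), h] at h2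
    simp only [hD] at h2
    have e : ∀ y, ((-‖A y‖ ^ 2 : ℝ) : ℂ) = -1 * (‖A y‖ : ℂ) ^ 2 := fun y => by push_cast; ring
    simp_rw [e]
    rw [h2, Complex.real_smul, mul_assoc]
    congr 3
    rw [Complex.I_sq]
    push_cast
    ring

theorem gaussWave_mul_conj (A : Conf n →L[ℝ] Conf n) (b : ℝ) (x y : Conf n) :
    gaussWave A b (y - x) * (starRingEnd ℂ) (gaussWave A b (y + x)) =
      Complex.exp (((-‖A y‖ ^ 2 - ‖A x‖ ^ 2 : ℝ) : ℂ)
        + Complex.I * ((-(2 * b) * inner ℝ x y : ℝ) : ℂ)) := by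
  rw [gaussWave, gaussWave, ← Complex.exp_conj, ← Complex.exp_add]
  congr 1
  simp only [map_add, map_mul, Complex.conj_ofReal, Complex.conj_I, map_sub]
  have h1 : ‖A y - A x‖ ^ 2 = ‖A y‖ ^ 2 - 2 * inner ℝ (A y) (A x) + ‖A x‖ ^ 2 :=
    norm_sub_sq_real _ _
  have h2 : ‖A y + A x‖ ^ 2 = ‖A y‖ ^ 2 + 2 * inner ℝ (A y) (A x) + ‖A x‖ ^ 2 :=
    norm_add_sq_real _ _
  have h3 : ‖y - x‖ ^ 2 = ‖y‖ ^ 2 - 2 * inner ℝ x y + ‖x‖ ^ 2 := by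
    rw [norm_sub_sq_real, real_inner_comm]
  have h4 : ‖y + x‖ ^ 2 = ‖y‖ ^ 2 + 2 * inner ℝ x y + ‖x‖ ^ 2 := by
    rw [norm_add_sq_real, real_inner_comm]
  rw [h1, h2, h3, h4]
  push_cast
  ring

theorem weyl_zero (hbar : ℝ) (ψ : Hilb n) : weyl hbar 0 ψ = ψ := by
  refine Lp.ext ?_
  have e1 : fstBlock (0 : Phase n) = 0 := rfl
  have e2 : sndBlock (0 : Phase n) = 0 := rfl
  filter_upwards [weyl_apply hbar 0 ψ] with y h
  rw [h, e1, e2]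
  simp

/-- Shifting the integration variable by half the translation vector absorbs the phase x·p/(2ħ). For
the chirped Gaussian the symmetric product then loses its real cross terms and its quadratic phase.
-/
theorem inner_weyl (hbar : ℝ) (z : Phase n) (ψ : Hilb n) (f : Conf n → ℂ) (hf : ψ =ᵐ[volume] f) :
    inner ℂ ψ (weyl hbar z ψ) = ∫ y, Complex.exp (Complex.I *
      ((hbar⁻¹ * inner ℝ (sndBlock z) y : ℝ) : ℂ)) *
        (f (y - (2⁻¹ : ℝ) • fstBlock z) * (starRingEnd ℂ) (f (y + (2⁻¹ : ℝ) • fstBlock z))) := by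
  rw [L2.inner_def, ← integral_add_right_eq_self (fun y => inner ℂ (ψ y) (weyl hbar z ψ y))
    ((2⁻¹ : ℝ) • fstBlock z)]
  refine integral_congr_ae ?_
  have h1 := (measurePreserving_add_right volume
    ((2⁻¹ : ℝ) • fstBlock z)).quasiMeasurePreserving.ae_eq_comp (weyl_apply hbar z ψ)
  have h2 := (measurePreserving_add_right volume
    ((2⁻¹ : ℝ) • fstBlock z)).quasiMeasurePreserving.ae_eq_comp hf
  have h3 := (measurePreserving_sub_right volume
    ((2⁻¹ : ℝ) • fstBlock z)).quasiMeasurePreserving.ae_eq_comp hf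
  filter_upwards [h1, h2, h3] with y e1 e2 e3
  simp only [Function.comp_apply] at e1 e2 e3
  have e4 : y + (2⁻¹ : ℝ) • fstBlock z - fstBlock z = y - (2⁻¹ : ℝ) • fstBlock z := by
    module
  rw [e1, e2, e4, e3, RCLike.inner_apply, mul_assoc]
  congr 3
  rw [inner_add_right, real_inner_smul_right, real_inner_comm (fstBlock z) (sndBlock z)]
  push_cast
  ring

/-- Gaussian unit vectors and their Weyl expectation values. -/
theorem exists_gaussian_vector (hbar : ℝ) (A : Conf n ≃L[ℝ] Conf n) (D : Conf n →L[ℝ] Conf n)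
    (hD : ∀ q z, inner ℝ (D q) (A z) = inner ℝ q z) (b : ℝ) :
    ∃ φ : Hilb n, ‖φ‖ = 1 ∧ ∀ z, inner ℂ φ (weyl hbar z φ) =
      Complex.exp ((-(‖A (fstBlock z)‖ ^ 2
        + ‖D (hbar⁻¹ • sndBlock z - b • fstBlock z)‖ ^ 2) / 4 : ℝ) : ℂ) := by
  obtain ⟨K, hK, hint⟩ := exists_integral_gaussian A D hD
  set ψ : Hilb n := (memLp_gaussWave A b).toLp with hψ
  have key : ∀ z, inner ℂ ψ (weyl hbar z ψ) = K * Complex.exp ((-(‖A (fstBlock z)‖ ^ 2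
        + ‖D (hbar⁻¹ • sndBlock z - b • fstBlock z)‖ ^ 2) / 4 : ℝ) : ℂ) := by
    intro z
    rw [inner_weyl hbar z ψ _ (memLp_gaussWave A b).coeFn_toLp]
    simp_rw [gaussWave_mul_conj, ← Complex.exp_add]
    have e : ∀ y : Conf n, Complex.I * ((hbar⁻¹ * inner ℝ (sndBlock z) y : ℝ) : ℂ)
        + (((-‖(A : Conf n →L[ℝ] Conf n) y‖ ^ 2
            - ‖(A : Conf n →L[ℝ] Conf n) ((2⁻¹ : ℝ) • fstBlock z)‖ ^ 2 : ℝ) : ℂ)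
          + Complex.I * ((-(2 * b) * inner ℝ ((2⁻¹ : ℝ) • fstBlock z) y : ℝ) : ℂ))
        = ((-‖A (fstBlock z)‖ ^ 2 / 4 : ℝ) : ℂ) + (((-‖A y‖ ^ 2 : ℝ) : ℂ) + Complex.I *
          ((inner ℝ (hbar⁻¹ • sndBlock z - b • fstBlock z) y : ℝ) : ℂ)) := by
      intro y
      simp only [ContinuousLinearEquiv.coe_coe, map_smul, norm_smul, inner_sub_left,
        real_inner_smul_left, mul_pow]
      norm_num
      ring
    simp_rw [e, Complex.exp_add (((-‖A (fstBlock z)‖ ^ 2 / 4 : ℝ) : ℂ))]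
    rw [integral_const_mul, hint, mul_left_comm, ← Complex.exp_add]
    congr 2
    push_cast
    ring
  -- At z = 0 this identifies K with ‖ψ‖², so dividing ψ by its norm removes the unknown constant.
  have h0 := key 0
  have e1 : fstBlock (0 : Phase n) = 0 := rfl
  have e2 : sndBlock (0 : Phase n) = 0 := rfl
  rw [weyl_zero, e1, e2] at h0
  simp only [smul_zero, sub_zero, map_zero, norm_zero] at h0
  rw [inner_self_eq_norm_sq_to_K] at h0
  norm_num at h0
  have hn : ‖ψ‖ ≠ 0 := by
    intro h
    rw [h] at h0
    exact hK (by simpa using h0.symm)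
  refine ⟨((‖ψ‖⁻¹ : ℝ) : ℂ) • ψ, ?_, fun z => ?_⟩
  · rw [norm_smul, Complex.norm_real, norm_inv, norm_norm, inv_mul_cancel₀ hn]
  · rw [map_smul, inner_smul_left, inner_smul_right, key, ← h0, Complex.conj_ofReal]
    have : (‖ψ‖ : ℂ) ≠ 0 := by exact_mod_cast hn
    push_cast
    field_simp

/-! ### Algebra of the Weyl operators and covariance -/

theorem inner_weyl_weyl (hbar : ℝ) (z : Phase n) (φ ψ : Hilb n) :
    inner ℂ (weyl hbar z φ) (weyl hbar z ψ) = inner ℂ φ ψ := by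
  rw [L2.inner_def, L2.inner_def,
    ← integral_sub_right_eq_self (fun y => inner ℂ (φ y) (ψ y)) (fstBlock z)]
  refine integral_congr_ae ?_
  filter_upwards [weyl_apply hbar z φ, weyl_apply hbar z ψ] with y e1 e2
  rw [e1, e2, RCLike.inner_apply, RCLike.inner_apply, map_mul, mul_mul_mul_comm, Complex.mul_conj,
    Complex.normSq_eq_norm_sq, mul_comm Complex.I, Complex.norm_exp_ofReal_mul_I]
  simp

theorem adjoint_weyl_weyl (hbar : ℝ) (z : Phase n) (φ : Hilb n) :
    ContinuousLinearMap.adjoint (weyl hbar z) (weyl hbar z φ) = φ := by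
  refine ext_inner_right ℂ fun ψ => ?_
  rw [ContinuousLinearMap.adjoint_inner_left, inner_weyl_weyl]

/-- The Weyl commutation relations. -/
theorem weyl_weyl (hbar : ℝ) (ζ z : Phase n) (φ : Hilb n) :
    weyl hbar ζ (weyl hbar z φ) =
      Complex.exp (Complex.I * ((hbar⁻¹ * (inner ℝ (sndBlock ζ) (fstBlock z)
        - inner ℝ (sndBlock z) (fstBlock ζ)) : ℝ) : ℂ)) • weyl hbar z (weyl hbar ζ φ) := by
  refine Lp.ext ?_
  have h1 := (measurePreserving_sub_right volume
    (fstBlock ζ)).quasiMeasurePreserving.ae_eq_comp (weyl_apply hbar z φ)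
  have h2 := (measurePreserving_sub_right volume
    (fstBlock z)).quasiMeasurePreserving.ae_eq_comp (weyl_apply hbar ζ φ)
  filter_upwards [weyl_apply hbar ζ (weyl hbar z φ), weyl_apply hbar z (weyl hbar ζ φ), h1, h2,
    Lp.coeFn_smul (Complex.exp (Complex.I * ((hbar⁻¹ * (inner ℝ (sndBlock ζ) (fstBlock z)
        - inner ℝ (sndBlock z) (fstBlock ζ)) : ℝ) : ℂ))) (weyl hbar z (weyl hbar ζ φ))]
    with y e1 e2 e3 e4 e5
  simp only [Function.comp_apply] at e3 e4
  rw [e5, Pi.smul_apply, e1, e2, e3, e4, sub_right_comm, smul_eq_mul, ← mul_assoc, ← mul_assoc,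
    ← mul_assoc, ← Complex.exp_add, ← Complex.exp_add, ← Complex.exp_add]
  congr 2
  simp only [inner_sub_right]
  push_cast
  ring

/-- Covariance applied to the translated-back set, with the Weyl operators cancelled by isometry. -/
theorem IsCovariant.scalarMeasure_weyl {hbar : ℝ} {u v : Conf n} {M : POVM (Hilb n) (Phase 1)}
    (hcov : IsCovariant hbar u v M) (z : Phase n) (φ : Hilb n) :
    M.scalarMeasure (weyl hbar z φ) = (M.scalarMeasure φ).map
      fun y => y + pair (inner ℝ u (fstBlock z)) (inner ℝ v (sndBlock z)) := by
  have hm : Measurable fun y : Phase 1 =>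
      y + pair (inner ℝ u (fstBlock z)) (inner ℝ v (sndBlock z)) := by fun_prop
  ext Z hZ
  rw [Measure.map_apply hm hZ, POVM.scalarMeasure_apply _ _ hZ,
    POVM.scalarMeasure_apply _ _ (hm hZ)]
  have h := hcov z _ (hm hZ)
  rw [Set.image_preimage_eq _ (add_right_surjective _)] at h
  rw [← h]
  simp only [ContinuousLinearMap.comp_apply, adjoint_weyl_weyl, inner_weyl_weyl]

theorem eq_zero_of_forall_exp_eq_one {c : ℝ}
    (h : ∀ t : ℝ, Complex.exp (Complex.I * ((t * c : ℝ) : ℂ)) = 1) : c = 0 := by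
  by_contra hc
  have h1 := h (Real.pi / c)
  rw [div_mul_cancel₀ _ hc, mul_comm, Complex.exp_pi_mul_I] at h1
  norm_num at h1

/-- Covariance determines the parameter `J` of a Gaussian bi-observable. -/
theorem IsGaussianBiobs.transpose_mulVec {hbar : ℝ} (hh : 0 < hbar) {u v : Conf n}
    {M : POVM (Hilb n) (Phase 1)} {μ : Phase 1} {V : Matrix (Fin 1 ⊕ Fin 1) (Fin 1 ⊕ Fin 1) ℝ}
    {J : Matrix (Fin 1 ⊕ Fin 1) (Fin n ⊕ Fin n) ℝ} (hM : IsGaussianBiobs hbar M μ V J)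
    (hcov : IsCovariant hbar u v M) (w : Phase 1) :
    Jᵀ *ᵥ w = blocks (w (Sum.inl 0) • u) (w (Sum.inr 0) • v) := by
  set η := Jᵀ *ᵥ w with hη
  -- A Gaussian test vector has nowhere vanishing Weyl expectations, so these can be cancelled when
  -- the characteristic functions at φ and at its Weyl translate are compared. What is left compares
  -- the commutation phase with the covariance phase.
  obtain ⟨φ, -, hφ⟩ := exists_gaussian_vector (n := n) hbar (ContinuousLinearEquiv.refl ℝ _)
    (ContinuousLinearMap.id ℝ _) (fun q z => rfl) 0
  have key : ∀ z : Phase n,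
      Complex.exp (Complex.I * ((inner ℝ (fstBlock η) (fstBlock z)
        + inner ℝ (sndBlock η) (sndBlock z) : ℝ) : ℂ)) =
      Complex.exp (Complex.I * ((w (Sum.inl 0) * inner ℝ u (fstBlock z)
        + w (Sum.inr 0) * inner ℝ v (sndBlock z) : ℝ) : ℂ)) := by
    intro z
    have h1 := hM.charFn_eq w (weyl hbar z φ)
    have h2 := hM.charFn_eq w φ
    rw [hcov.scalarMeasure_weyl, integral_map (by fun_prop) (by fun_prop)] at h1
    have e : ∀ y : Phase 1, Complex.exp (Complex.I * ((w ⬝ᵥ (y + pair (inner ℝ u (fstBlock z))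
        (inner ℝ v (sndBlock z))) : ℝ) : ℂ)) =
        Complex.exp (Complex.I * ((w (Sum.inl 0) * inner ℝ u (fstBlock z)
          + w (Sum.inr 0) * inner ℝ v (sndBlock z) : ℝ) : ℂ)) *
          Complex.exp (Complex.I * ((w ⬝ᵥ y : ℝ) : ℂ)) := by
      intro y
      rw [← Complex.exp_add, dotProduct_add]
      congr 1
      have : w ⬝ᵥ pair (inner ℝ u (fstBlock z)) (inner ℝ v (sndBlock z))
          = w (Sum.inl 0) * inner ℝ u (fstBlock z) + w (Sum.inr 0) * inner ℝ v (sndBlock z) := by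
        simp [dotProduct, pair]
      rw [this]
      push_cast
      ring
    simp_rw [e] at h1
    rw [integral_const_mul, h2] at h1
    simp only [smul_apply, inner_smul_right] at h1
    rw [weyl_weyl, inner_smul_right, inner_weyl_weyl, mul_left_comm] at h1
    have hne : inner ℂ φ (weyl hbar (-(Omega hbar n *ᵥ η)) φ) ≠ 0 := by
      rw [hφ]; exact Complex.exp_ne_zero _
    have h3 := mul_right_cancel₀ hne (mul_left_cancel₀ (Complex.exp_ne_zero _)
      (show gaussFn μ V w * (_ * _) = gaussFn μ V w * (_ * _) from h1))
    rw [h3]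
    congr 3
    rw [fstBlock_neg_Omega, sndBlock_neg_Omega, inner_neg_right, real_inner_smul_left,
      real_inner_smul_right, real_inner_comm (sndBlock η) (sndBlock z)]
    field_simp
    ring
  have h0 : ∀ x p : Conf n, inner ℝ (fstBlock η - w (Sum.inl 0) • u) x
      + inner ℝ (sndBlock η - w (Sum.inr 0) • v) p = 0 := by
    intro x p
    refine eq_zero_of_forall_exp_eq_one fun t => ?_
    have h := key (t • blocks x p)
    rw [smul_blocks, fstBlock_blocks, sndBlock_blocks] at h
    have hne := Complex.exp_ne_zero (Complex.I * ((w (Sum.inl 0) * inner ℝ u (t • x)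
        + w (Sum.inr 0) * inner ℝ v (t • p) : ℝ) : ℂ))
    rw [← mul_left_inj' hne, one_mul, ← Complex.exp_add]
    refine Eq.trans ?_ h
    congr 1
    simp only [inner_sub_left, real_inner_smul_left, real_inner_smul_right]
    push_cast
    ring
  have h1 := h0 (fstBlock η - w (Sum.inl 0) • u) 0
  have h2 := h0 0 (sndBlock η - w (Sum.inr 0) • v)
  rw [inner_zero_right, add_zero, inner_self_eq_zero, sub_eq_zero] at h1
  rw [inner_zero_right, zero_add, inner_self_eq_zero, sub_eq_zero] at h2
  rw [← blocks_eta η, h1, h2]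

/-! ### Distributions in Gaussian states -/

/-- Nonnegativity of s is derived, not assumed: a characteristic function is bounded by 1, and t = 1
suffices. -/
theorem eq_gaussianReal_of_charFun {P : Measure ℝ} [IsProbabilityMeasure P] {m s : ℝ}
    (h : ∀ t : ℝ, charFun P t
      = Complex.exp (Complex.I * ((t * m : ℝ) : ℂ) - ((t ^ 2 * s : ℝ) : ℂ) / 2)) :
    Var[id; P] = s ∧ 0 ≤ s ∧ P = gaussianReal m s.toNNReal := by
  have hs : 0 ≤ s := by
    have h1 := norm_charFun_le_one (μ := P) 1
    rw [h 1, Complex.norm_exp, Real.exp_le_one_iff] at h1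
    have e : (Complex.I * ((1 * m : ℝ) : ℂ) - (((1 : ℝ) ^ 2 * s : ℝ) : ℂ) / 2).re = -(s / 2) := by
      simp
    rw [e] at h1
    linarith
  have hP : P = gaussianReal m s.toNNReal := by
    refine Measure.ext_of_charFun (funext fun t => ?_)
    rw [h, charFun_gaussianReal]
    congr 1
    rw [Real.coe_toNNReal _ hs]
    push_cast
    ring
  refine ⟨?_, hs, hP⟩
  rw [hP, variance_id_gaussianReal, Real.coe_toNNReal _ hs]

theorem gaussFn_smul {ι : Type*} [Fintype ι] (μ : ι → ℝ) (V : Matrix ι ι ℝ) (t : ℝ) (e : ι → ℝ) :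
    gaussFn μ V (t • e) = Complex.exp (Complex.I * ((t * (e ⬝ᵥ μ) : ℝ) : ℂ)
      - ((t ^ 2 * (e ⬝ᵥ (V *ᵥ e)) : ℝ) : ℂ) / 2) := by
  rw [gaussFn, Matrix.mulVec_smul, smul_dotProduct, smul_dotProduct, dotProduct_smul, smul_eq_mul,
    smul_eq_mul, smul_eq_mul, ← mul_assoc, sq]

theorem tr_mul_smul_weyl (hbar : ℝ) (ρ : State (Hilb n)) (c : ℂ) (w : Phase n) :
    tr (ρ.op * (c • weyl hbar (-(Omega hbar n *ᵥ w)))) = c * ρ.charFn hbar w := by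
  rw [State.charFn, tr, tr, ← tsum_mul_left]
  refine tsum_congr fun i => ?_
  rw [mul_smul_comm, smul_apply, inner_smul_right]

/-- The characteristic function of M at w = (t, 0), where Jᵀw = t(u, 0). The product form says that
the marginal is the target convolved with Gaussian noise. -/
theorem charFun_fstMarginal_distr {hbar : ℝ} (hh : 0 < hbar) {u v : Conf n}
    {M : POVM (Hilb n) (Phase 1)} {μ : Phase 1} {V : Matrix (Fin 1 ⊕ Fin 1) (Fin 1 ⊕ Fin 1) ℝ}
    {J : Matrix (Fin 1 ⊕ Fin 1) (Fin n ⊕ Fin n) ℝ} (hM : IsGaussianBiobs hbar M μ V J)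
    (hcov : IsCovariant hbar u v M) (ρ : State (Hilb n)) (t : ℝ) :
    charFun ((fstMarginal M).distr ρ) t =
      gaussFn μ V (t • pair 1 0) * ρ.charFn hbar (t • blocks u 0) := by
  have hJ : Jᵀ *ᵥ (t • pair 1 0) = t • blocks u 0 := by
    rw [hM.transpose_mulVec hh hcov, smul_blocks]
    simp [pair]
  rw [← tr_mul_smul_weyl, ← hJ]
  refine POVM.charFun_distr _ ρ _ t fun ψ => ?_
  rw [← hM.charFn_eq, fstMarginal, POVM.scalarMeasure_map, charFun_apply,
    integral_map (measurable_pi_apply _).aemeasurable (by fun_prop)]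
  refine integral_congr_ae (Filter.Eventually.of_forall fun y => ?_)
  simp [pair, dotProduct, mul_comm]

theorem charFun_sndMarginal_distr {hbar : ℝ} (hh : 0 < hbar) {u v : Conf n}
    {M : POVM (Hilb n) (Phase 1)} {μ : Phase 1} {V : Matrix (Fin 1 ⊕ Fin 1) (Fin 1 ⊕ Fin 1) ℝ}
    {J : Matrix (Fin 1 ⊕ Fin 1) (Fin n ⊕ Fin n) ℝ} (hM : IsGaussianBiobs hbar M μ V J)
    (hcov : IsCovariant hbar u v M) (ρ : State (Hilb n)) (t : ℝ) :
    charFun ((sndMarginal M).distr ρ) t =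
      gaussFn μ V (t • pair 0 1) * ρ.charFn hbar (t • blocks 0 v) := by
  have hJ : Jᵀ *ᵥ (t • pair 0 1) = t • blocks 0 v := by
    rw [hM.transpose_mulVec hh hcov, smul_blocks]
    simp [pair]
  rw [← tr_mul_smul_weyl, ← hJ]
  refine POVM.charFun_distr _ ρ _ t fun ψ => ?_
  rw [← hM.charFn_eq, sndMarginal, POVM.scalarMeasure_map, charFun_apply,
    integral_map (measurable_pi_apply _).aemeasurable (by fun_prop)]
  refine integral_congr_ae (Filter.Eventually.of_forall fun y => ?_)
  simp [pair, dotProduct, mul_comm]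

/-- Relative entropy of a Gaussian distribution from its convolution with Gaussian noise, in terms
of characteristic functions. -/
theorem relEntropy_of_charFun {P R : Measure ℝ} [IsProbabilityMeasure P] [IsProbabilityMeasure R]
    {m s a d : ℝ} (hs : 0 < s) (hd : 0 ≤ d)
    (hP : ∀ t : ℝ, charFun P t
      = Complex.exp (Complex.I * ((t * m : ℝ) : ℂ) - ((t ^ 2 * s : ℝ) : ℂ) / 2))
    (hR : ∀ t : ℝ, charFun R t
      = Complex.exp (Complex.I * ((t * a : ℝ) : ℂ) - ((t ^ 2 * d : ℝ) : ℂ) / 2) * charFun P t) :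
    relEntropy P R
      = ENNReal.ofReal (Real.logb 2 (Real.exp 1) / 2 * (sFn (d / s) + a ^ 2 / (d + s))) := by
  obtain ⟨-, -, hP'⟩ := eq_gaussianReal_of_charFun hP
  obtain ⟨-, -, hR'⟩ := eq_gaussianReal_of_charFun (P := R) (m := m + a) (s := s + d) fun t => by
    rw [hR, hP, ← Complex.exp_add]
    congr 1
    push_cast
    ring
  rw [hP', hR', Real.toNNReal_add hs.le hd, relEntropy_gaussianReal m a
    (Real.toNNReal_pos.2 hs).ne', Real.coe_toNNReal _ hs.le, Real.coe_toNNReal _ hd]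

/-- The term (i/2)JΩJᵀ is purely imaginary entrywise, so real parts of the diagonal see V alone. -/
theorem IsGaussianBiobs.diag_nonneg {hbar : ℝ} {M : POVM (Hilb n) (Phase 1)} {μ : Phase 1}
    {V : Matrix (Fin 1 ⊕ Fin 1) (Fin 1 ⊕ Fin 1) ℝ} {J : Matrix (Fin 1 ⊕ Fin 1) (Fin n ⊕ Fin n) ℝ}
    (hM : IsGaussianBiobs hbar M μ V J) (i : Fin 1 ⊕ Fin 1) : 0 ≤ V i i := by
  have h := (Complex.le_def.1 (hM.posSemidef_add.diag_nonneg (i := i))).1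
  simpa [-Matrix.map_mul] using h

/-- The error function of a Gaussian bi-observable in a Gaussian state. -/
theorem errorFn_eq_gaussianError {hbar : ℝ} (hh : 0 < hbar) {u v : Conf n}
    {M : POVM (Hilb n) (Phase 1)} {μ : Phase 1} {V : Matrix (Fin 1 ⊕ Fin 1) (Fin 1 ⊕ Fin 1) ℝ}
    {J : Matrix (Fin 1 ⊕ Fin 1) (Fin n ⊕ Fin n) ℝ} (hM : IsGaussianBiobs hbar M μ V J)
    (hcov : IsCovariant hbar u v M) {ρ : State (Hilb n)} (hρ : ρ.IsGaussian hbar)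
    (h1 : 0 < varPos u ρ) (h2 : 0 < varMom hbar v ρ) :
    errorFn hbar u v ρ M = ENNReal.ofReal (gaussianError μ V (varPos u ρ) (varMom hbar v ρ)) := by
  obtain ⟨μ', V', -, -, hchar⟩ := hρ
  have hP : ∀ t, charFun ((posAlong u).distr ρ) t = _ := fun t =>
    (charFun_posAlong_distr hh u ρ t).trans ((hchar _).trans (gaussFn_smul μ' V' t _))
  have hQ : ∀ t, charFun ((momAlong hbar v).distr ρ) t = _ := fun t =>
    (charFun_momAlong_distr hbar v ρ t).trans ((hchar _).trans (gaussFn_smul μ' V' t _))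
  obtain ⟨vP, -, -⟩ := eq_gaussianReal_of_charFun hP
  obtain ⟨vQ, -, -⟩ := eq_gaussianReal_of_charFun hQ
  rw [← varPos] at vP
  rw [← varMom] at vQ
  rw [← vP] at hP
  rw [← vQ] at hQ
  have d1 := hM.diag_nonneg (Sum.inl 0)
  have d2 := hM.diag_nonneg (Sum.inr 0)
  rw [errorFn, relEntropy_of_charFun h1 d1 hP (a := μ (Sum.inl 0)),
    relEntropy_of_charFun h2 d2 hQ (a := μ (Sum.inr 0)), ← ENNReal.ofReal_add]
  · congr 1
    rw [gaussianError]
    ring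
  · exact mul_nonneg logb_exp_nonneg (add_nonneg (sFn_nonneg (by positivity)) (by positivity))
  · exact mul_nonneg logb_exp_nonneg (add_nonneg (sFn_nonneg (by positivity)) (by positivity))
  · intro t
    rw [charFun_sndMarginal_distr hh hM hcov, charFun_momAlong_distr, gaussFn_smul]
    simp [pair, dotProduct, Matrix.mulVec]
  · intro t
    rw [charFun_fstMarginal_distr hh hM hcov, charFun_posAlong_distr hh, gaussFn_smul]
    simp [pair, dotProduct, Matrix.mulVec]

/-! ### Existence of Gaussian states with prescribed variances -/

/-- The real matrix whose Gram matrix is twice the covariance matrix of a chirped Gaussian. -/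
def gramFactor (hbar : ℝ) (a d : Matrix (Fin n) (Fin n) ℝ) (b : ℝ) :
    Matrix (Fin n ⊕ Fin n) (Fin n ⊕ Fin n) ℝ :=
  Matrix.fromBlocks 0 (hbar • a) d ((b * hbar) • d)

/-- The symplectic complex structure. -/
def complexStructure (n : ℕ) : Matrix (Fin n ⊕ Fin n) (Fin n ⊕ Fin n) ℝ :=
  Matrix.fromBlocks 0 (-1) 1 0

/-- The chirp only enters the lower right block, where its contributions bħ²dᵀa and -bħ²aᵀd cancel.
-/
theorem gramFactor_symplectic (hbar : ℝ) {a d : Matrix (Fin n) (Fin n) ℝ} (h : dᵀ * a = 1)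
    (b : ℝ) :
    (gramFactor hbar a d b)ᵀ * complexStructure n * gramFactor hbar a d b = Omega hbar n := by
  have h' : aᵀ * d = 1 := by
    rw [← Matrix.transpose_inj, Matrix.transpose_mul, Matrix.transpose_transpose, h,
      Matrix.transpose_one]
  simp only [gramFactor, complexStructure, Omega, Matrix.fromBlocks_transpose,
    Matrix.fromBlocks_multiply]
  congr 1 <;> simp [h, h', mul_comm]
  module

/-- With K the complex structure, the matrix is ½G*(1 + iK)G. Since K* = -K and K² = -1, the
Hermitian matrix 1 + iK is twice a projection, which exhibits the whole as a Gram matrix. -/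
theorem posSemidef_gram_add {G Ω : Matrix (Fin n ⊕ Fin n) (Fin n ⊕ Fin n) ℝ}
    (hG : Gᵀ * complexStructure n * G = Ω) :
    (((1 / 2 : ℝ) • (Gᵀ * G)).map Complex.ofReal
      + (Complex.I / 2) • Ω.map Complex.ofReal).PosSemidef := by
  set G' : Matrix (Fin n ⊕ Fin n) (Fin n ⊕ Fin n) ℂ := G.map Complex.ofReal with hG'
  set K : Matrix (Fin n ⊕ Fin n) (Fin n ⊕ Fin n) ℂ := (complexStructure n).map Complex.ofReal
    with hK
  have hmap : ∀ X Y : Matrix (Fin n ⊕ Fin n) (Fin n ⊕ Fin n) ℝ,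
      (X * Y).map Complex.ofReal = X.map Complex.ofReal * Y.map Complex.ofReal :=
    fun X Y => Matrix.map_mul (f := Complex.ofRealHom)
  have hGt : G'ᴴ = Gᵀ.map Complex.ofReal := by
    ext i j; simp [hG']
  have hKt : Kᴴ = -K := by
    ext (i | i) (j | j) <;> simp [hK, complexStructure, Matrix.one_apply, eq_comm]
  have hKK : K * K = -1 := by
    have : complexStructure n * complexStructure n = -1 := by
      rw [complexStructure, Matrix.fromBlocks_multiply, ← Matrix.fromBlocks_one,
        Matrix.fromBlocks_neg]
      simp
    rw [hK, ← hmap, this]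
    ext i j
    simp [Matrix.one_apply, apply_ite]
  have hΩ : Ω.map Complex.ofReal = G'ᴴ * K * G' := by
    rw [← hG, hGt, hK, hG', hmap, hmap]
  have hV : ((1 / 2 : ℝ) • (Gᵀ * G)).map Complex.ofReal = (1 / 2 : ℂ) • (G'ᴴ * G') := by
    rw [hGt, hG', ← hmap]
    ext i j
    simp [-Matrix.map_mul]
  have key : ((1 / 2 : ℝ) • (Gᵀ * G)).map Complex.ofReal + (Complex.I / 2) • Ω.map Complex.ofReal
      = ((1 / 2 : ℂ) • ((1 + Complex.I • K) * G'))ᴴ * ((1 / 2 : ℂ) • ((1 + Complex.I • K) * G')) := by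
    have e : (1 + Complex.I • K) * (1 + Complex.I • K) = (2 : ℂ) • (1 + Complex.I • K) := by
      rw [add_mul, one_mul, mul_add, mul_one, smul_mul_smul_comm, Complex.I_mul_I, hKK]
      module
    have e' : (1 + Complex.I • K)ᴴ = 1 + Complex.I • K := by
      rw [Matrix.conjTranspose_add, Matrix.conjTranspose_smul, hKt]
      simp
    rw [Matrix.conjTranspose_smul, Matrix.conjTranspose_mul, e', smul_mul_smul_comm, mul_assoc,
      ← mul_assoc (1 + Complex.I • K), e, hV, hΩ, smul_mul_assoc, mul_smul_comm, add_mul, mul_add,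
      one_mul, smul_mul_assoc, mul_smul_comm, mul_assoc]
    simp
    module
  rw [key]
  exact Matrix.posSemidef_conjTranspose_mul_self _

/-- Pure Gaussian states. -/
theorem exists_gaussian_state {hbar : ℝ} (hh : 0 < hbar) {a d : Matrix (Fin n) (Fin n) ℝ}
    (h : dᵀ * a = 1) (b : ℝ) :
    ∃ ρ : State (Hilb n), ρ.IsGaussian hbar ∧ ∀ w, ρ.charFn hbar w =
      Complex.exp ((-((hbar ^ 2 * ‖Matrix.toEuclideanCLM (𝕜 := ℝ) a (sndBlock w)‖ ^ 2
        + ‖Matrix.toEuclideanCLM (𝕜 := ℝ) d (fstBlock w + (b * hbar) • sndBlock w)‖ ^ 2) / 4)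
          : ℝ) : ℂ) := by
  set T : Matrix (Fin n) (Fin n) ℝ → Conf n →L[ℝ] Conf n :=
    fun m => Matrix.toEuclideanCLM (𝕜 := ℝ) m with hT
  have hmul : ∀ m m' x, T m (T m' x) = T (m * m') x := fun m m' x => by
    simp only [hT, map_mul]; rfl
  have h1 : ∀ x, T 1 x = x := fun x => by simp only [hT, map_one]; rfl
  let A : Conf n ≃L[ℝ] Conf n := ContinuousLinearEquiv.equivOfInverse (T a) (T dᵀ)
    (fun x => by rw [hmul, h, h1]) (fun x => by rw [hmul, mul_eq_one_comm.1 h, h1])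
  have hD : ∀ q z, inner ℝ (T d q) (A z) = inner ℝ q z := by
    intro q z
    have e : T dᵀ = ContinuousLinearMap.adjoint (T d) := by
      have := map_star (Matrix.toEuclideanCLM (𝕜 := ℝ) (n := Fin n)) d
      rw [Matrix.star_eq_conjTranspose, Matrix.conjTranspose_eq_transpose_of_trivial] at this
      exact this
    change inner ℝ (T d q) (T a z) = _
    rw [← ContinuousLinearMap.adjoint_inner_right, ← e, hmul, h, h1]
  obtain ⟨φ, hφ1, hφ⟩ := exists_gaussian_vector hbar A (T d) hD b
  have hchar : ∀ w, (pureState φ hφ1).charFn hbar w =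
      Complex.exp ((-((hbar ^ 2 * ‖T a (sndBlock w)‖ ^ 2
        + ‖T d (fstBlock w + (b * hbar) • sndBlock w)‖ ^ 2) / 4) : ℝ) : ℂ) := by
    intro w
    rw [State.charFn, tr_pureState_mul, hφ, fstBlock_neg_Omega, sndBlock_neg_Omega, smul_smul,
      inv_mul_cancel₀ hh.ne', one_smul, smul_neg, sub_neg_eq_add, smul_smul, map_neg, norm_neg,
      map_smul, norm_smul, mul_pow, Real.norm_eq_abs, sq_abs, neg_div]
    rfl
  refine ⟨pureState φ hφ1, ⟨0, (1 / 2 : ℝ) • ((gramFactor hbar a d b)ᵀ * gramFactor hbar a d b),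
    ?_, posSemidef_gram_add (gramFactor_symplectic hbar h b), fun w => ?_⟩, hchar⟩
  · rw [Matrix.IsSymm, Matrix.transpose_smul, Matrix.transpose_mul, Matrix.transpose_transpose]
  · rw [hchar, gaussFn]
    have e : w ⬝ᵥ (((1 / 2 : ℝ) • ((gramFactor hbar a d b)ᵀ * gramFactor hbar a d b)) *ᵥ w)
        = (hbar ^ 2 * ‖T a (sndBlock w)‖ ^ 2
          + ‖T d (fstBlock w + (b * hbar) • sndBlock w)‖ ^ 2) / 2 := by
      have e0 : gramFactor hbar a d b *ᵥ w = blocks (hbar • T a (sndBlock w))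
          (T d (fstBlock w + (b * hbar) • sndBlock w)) := by
        rw [gramFactor, Matrix.fromBlocks_mulVec]
        simp only [hT, map_add, map_smul]
        ext (i | i) <;>
          simp [blocks, fstBlock, sndBlock, Matrix.smul_mulVec] <;> first | rfl | exact Or.inl rfl
      rw [Matrix.smul_mulVec, dotProduct_smul, ← Matrix.mulVec_mulVec, Matrix.dotProduct_mulVec,
        Matrix.vecMul_transpose, e0]
      have e1 : ∀ x p : Conf n, blocks x p ⬝ᵥ blocks x p = ‖x‖ ^ 2 + ‖p‖ ^ 2 := by
        intro x p
        rw [EuclideanSpace.real_norm_sq_eq, EuclideanSpace.real_norm_sq_eq]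
        simp [blocks, dotProduct, sq]
      rw [e1, norm_smul, mul_pow, Real.norm_eq_abs, sq_abs, smul_eq_mul]
      ring
    rw [e, dotProduct_zero]
    congr 1
    push_cast
    ring

theorem varPos_eq_of_charFn {hbar : ℝ} (hh : 0 < hbar) {u : Conf n} {ρ : State (Hilb n)} {s : ℝ}
    (h : ∀ t : ℝ, ρ.charFn hbar (t • blocks u 0) = Complex.exp ((-(t ^ 2 * s / 2) : ℝ) : ℂ)) :
    varPos u ρ = s := by
  refine (eq_gaussianReal_of_charFun (P := (posAlong u).distr ρ) (m := 0) fun t => ?_).1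
  rw [charFun_posAlong_distr hh, h]
  simp

theorem varMom_eq_of_charFn {hbar : ℝ} {v : Conf n} {ρ : State (Hilb n)} {s : ℝ}
    (h : ∀ t : ℝ, ρ.charFn hbar (t • blocks 0 v) = Complex.exp ((-(t ^ 2 * s / 2) : ℝ) : ℂ)) :
    varMom hbar v ρ = s := by
  refine (eq_gaussianReal_of_charFun (P := (momAlong hbar v).distr ρ) (m := 0) fun t => ?_).1
  rw [charFun_momAlong_distr, h]
  simp

/-- Shear matrices with prescribed action on two vectors. -/
theorem exists_shear {u v : Conf n} (hu : ‖u‖ = 1) (hv : ‖v‖ = 1) {σ : ℝ} (hσ : 0 < σ)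
    {δ : ℝ} (hδ : 0 < δ) (h : inner ℝ u v ^ 2 * σ ^ 2 ≤ δ) :
    ∃ a d : Matrix (Fin n) (Fin n) ℝ, dᵀ * a = 1 ∧
      Matrix.toEuclideanCLM (𝕜 := ℝ) d u = σ⁻¹ • u ∧
      ‖Matrix.toEuclideanCLM (𝕜 := ℝ) a v‖ ^ 2 ≤ δ := by
  have huu : u ⬝ᵥ u = 1 := by
    have := real_inner_self_eq_norm_sq u
    rw [hu, EuclideanSpace.inner_eq_star_dotProduct] at this
    simpa using this
  have huv : u ⬝ᵥ v = inner ℝ u v := by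
    rw [EuclideanSpace.inner_eq_star_dotProduct]
    simp [dotProduct_comm]
  obtain ⟨τ, g, hτ, hg, hgv⟩ : ∃ (τ : ℝ) (g : Conf n), 0 < τ ∧ τ + u ⬝ᵥ g = σ ∧
      ‖τ • v + (inner ℝ u v : ℝ) • g‖ ^ 2 ≤ δ := by
    -- With a = τ1 + guᵀ one has aᵀu = (τ + u·g)u = σu and av = τv + (u·v)g. If u·v ≠ 0, g is chosen
    -- so that av = (u·v)σu, the length allowed by the hypothesis. If u·v = 0, g does not affect av,
    -- and τ = √δ makes |av|² = δ.
    by_cases hc : (inner ℝ u v : ℝ) = 0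
    · refine ⟨Real.sqrt δ, (σ - Real.sqrt δ) • u, Real.sqrt_pos.2 hδ, ?_, ?_⟩
      · simp [huu]
      · rw [hc, zero_smul, add_zero, norm_smul, hv, mul_one, Real.norm_eq_abs, sq_abs,
          Real.sq_sqrt hδ.le]
    · refine ⟨1, σ • u - (inner ℝ u v : ℝ)⁻¹ • v, one_pos, ?_, ?_⟩
      · simp [dotProduct_sub, huu, huv, hc]
      · rw [one_smul, smul_sub, smul_smul, smul_smul, mul_inv_cancel₀ hc, one_smul,
          add_sub_cancel, norm_smul, hu, mul_one, Real.norm_eq_abs, sq_abs, mul_pow]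
        exact h
  -- The second matrix is the inverse transpose of the first, by the Sherman–Morrison formula.
  refine ⟨τ • 1 + Matrix.vecMulVec g u, τ⁻¹ • (1 - σ⁻¹ • Matrix.vecMulVec u g), ?_, ?_, ?_⟩
  · have e : Matrix.vecMulVec (g : Fin n → ℝ) u * Matrix.vecMulVec g u
        = (σ - τ) • Matrix.vecMulVec g u := by
      rw [Matrix.vecMulVec_mul_vecMulVec, ← hg]
      ext i j
      simp [Matrix.vecMulVec_apply]
      ring
    rw [Matrix.transpose_smul, Matrix.transpose_sub, Matrix.transpose_smul, Matrix.transpose_one,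
      Matrix.transpose_vecMulVec, smul_mul_assoc, sub_mul, one_mul, mul_add, smul_mul_assoc,
      smul_mul_assoc, mul_smul_comm, mul_one, e, smul_smul, smul_smul]
    rw [show τ • (1 : Matrix (Fin n) (Fin n) ℝ) + Matrix.vecMulVec g u
      - ((σ⁻¹ * τ) • Matrix.vecMulVec (g : Fin n → ℝ) u
        + (σ⁻¹ * (σ - τ)) • Matrix.vecMulVec (g : Fin n → ℝ) u) = τ • 1
        + (1 - σ⁻¹ * σ) • Matrix.vecMulVec (g : Fin n → ℝ) u by module, inv_mul_cancel₀ hσ.ne',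
      sub_self, zero_smul, add_zero, smul_smul, inv_mul_cancel₀ hτ.ne', one_smul]
  · ext i
    rw [Matrix.ofLp_toEuclideanCLM, Matrix.smul_mulVec, Matrix.sub_mulVec, Matrix.one_mulVec,
      Matrix.smul_mulVec, Matrix.vecMulVec_mulVec]
    have : (g : Fin n → ℝ) ⬝ᵥ u = σ - τ := by rw [dotProduct_comm, ← hg]; ring
    simp [this]
    field_simp
    ring
  · convert! hgv using 3
    ext i
    rw [Matrix.ofLp_toEuclideanCLM, Matrix.add_mulVec, Matrix.smul_mulVec, Matrix.one_mulVec,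
      Matrix.vecMulVec_mulVec]
    simp [huv]

/-- The shear fixes the position variance at ε₁ and leaves an unchirped momentum variance of at most
ε₂; the chirp supplies the missing part without changing the position distribution. -/
theorem exists_gaussian_state_of_var {hbar : ℝ} (hh : 0 < hbar) {u v : Conf n} (hu : ‖u‖ = 1)
    (hv : ‖v‖ = 1) {ε₁ ε₂ : ℝ} (h₁ : 0 < ε₁) (h₂ : 0 < ε₂)
    (h : hbar ^ 2 / 4 * inner ℝ u v ^ 2 ≤ ε₁ * ε₂) :
    ∃ ρ : State (Hilb n), ρ.IsGaussian hbar ∧ varPos u ρ = ε₁ ∧ varMom hbar v ρ = ε₂ := by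
  set σ := (Real.sqrt (2 * ε₁))⁻¹ with hσ'
  have hσ : 0 < σ := by positivity
  have hσ2 : σ⁻¹ ^ 2 = 2 * ε₁ := by rw [hσ', inv_inv, Real.sq_sqrt (by positivity)]
  obtain ⟨a, d, had, hdu, hav⟩ := exists_shear hu hv hσ (δ := 2 * ε₂ / hbar ^ 2) (by positivity)
    (by
      have : σ ^ 2 = (2 * ε₁)⁻¹ := by rw [← hσ2, inv_pow, inv_inv]
      rw [this, le_div_iff₀ (by positivity), ← div_eq_mul_inv, div_mul_eq_mul_div,
        div_le_iff₀ (by positivity)]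
      linarith)
  set A := ‖Matrix.toEuclideanCLM (𝕜 := ℝ) a v‖ ^ 2 with hA
  set D := ‖Matrix.toEuclideanCLM (𝕜 := ℝ) d v‖ ^ 2 with hD
  -- The chirp acts on the momentum variance through |dv|², which is nonzero because d is
  -- invertible.
  have hD0 : 0 < D := by
    have : Matrix.toEuclideanCLM (𝕜 := ℝ) d v ≠ 0 := by
      intro h0
      have h3 : aᵀ * d = 1 := by
        rw [← Matrix.transpose_inj, Matrix.transpose_mul, Matrix.transpose_transpose, had,
          Matrix.transpose_one]
      have h4 : Matrix.toEuclideanCLM (𝕜 := ℝ) aᵀ (Matrix.toEuclideanCLM (𝕜 := ℝ) d v) = v := by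
        change (Matrix.toEuclideanCLM (𝕜 := ℝ) aᵀ * Matrix.toEuclideanCLM (𝕜 := ℝ) d) v = v
        rw [← map_mul, h3, map_one]
        rfl
      rw [h0, map_zero] at h4
      rw [← h4, norm_zero] at hv
      exact zero_ne_one hv
    positivity
  rw [le_div_iff₀ (by positivity)] at hav
  obtain ⟨ρ, hρ, hchar⟩ := exists_gaussian_state hh had
    -- Solves ħ²(A + b²D)/2 = ε₂ for the chirp b; the radicand is nonnegative by `hav`.
    (Real.sqrt ((2 * ε₂ - A * hbar ^ 2) / (hbar ^ 2 * D)))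
  set b := Real.sqrt ((2 * ε₂ - A * hbar ^ 2) / (hbar ^ 2 * D)) with hb
  have hb2 : b ^ 2 * (hbar ^ 2 * D) = 2 * ε₂ - A * hbar ^ 2 := by
    rw [hb, Real.sq_sqrt (div_nonneg (by linarith) (by positivity)),
      div_mul_cancel₀ _ (by positivity)]
  refine ⟨ρ, hρ, varPos_eq_of_charFn hh fun t => ?_, varMom_eq_of_charFn fun t => ?_⟩
  · rw [hchar, smul_blocks, fstBlock_blocks, sndBlock_blocks]
    simp only [smul_zero, map_zero, norm_zero, add_zero, map_smul, hdu, norm_smul, hu, mul_one,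
      mul_pow, Real.norm_eq_abs, sq_abs, hσ2]
    congr 2
    ring
  · rw [hchar, smul_blocks, fstBlock_blocks, sndBlock_blocks]
    simp only [smul_zero, zero_add, map_smul, norm_smul, mul_pow, Real.norm_eq_abs, sq_abs]
    rw [← hA, ← hD]
    congr 2
    linear_combination (-t ^ 2 / 4) * hb2

end QM

/-! ### The divergence at minimal variances -/

theorem mainTheorem5 (n : ℕ) (hbar : ℝ) (hhbar : 0 < hbar)
    (u v : EuclideanSpace ℝ (Fin n)) (hu : ‖u‖ = 1) (hv : ‖v‖ = 1)
    (α : ℝ) (hα : inner ℝ u v = Real.cos α)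
    (ε₁ ε₂ : ℝ) (hε₁ : 0 < ε₁) (hε₂ : 0 < ε₂)
    (M : QM.POVM (QM.Hilb n) (QM.Phase 1)) (μ : QM.Phase 1)
    (V : Matrix (Fin 1 ⊕ Fin 1) (Fin 1 ⊕ Fin 1) ℝ)
    (J : Matrix (Fin 1 ⊕ Fin 1) (Fin n ⊕ Fin n) ℝ)
    (hM : QM.IsGaussianBiobs hbar M μ V J) (hcov : QM.IsCovariant hbar u v M) :
    (hbar ^ 2 / 4 * Real.cos α ^ 2 ≤ ε₁ * ε₂ →
      (∃ ρ : QM.State (QM.Hilb n),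
        ρ.IsGaussian hbar ∧ QM.varPos u ρ = ε₁ ∧ QM.varMom hbar v ρ = ε₂) ∧
      ∀ ρ : QM.State (QM.Hilb n),
        ρ.IsGaussian hbar → QM.varPos u ρ = ε₁ → QM.varMom hbar v ρ = ε₂ →
          QM.divergence hbar u v ε₁ ε₂ M = QM.errorFn hbar u v ρ M ∧
          QM.errorFn hbar u v ρ M = ENNReal.ofReal (QM.gaussianError μ V ε₁ ε₂)) ∧
    (ε₁ * ε₂ < hbar ^ 2 / 4 * Real.cos α ^ 2 →
      (∃ ρ : QM.State (QM.Hilb n),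
        ρ.IsGaussian hbar ∧ QM.varPos u ρ = ε₁ ∧
          QM.varMom hbar v ρ = hbar ^ 2 / (4 * ε₁) * Real.cos α ^ 2) ∧
      ∀ ρ : QM.State (QM.Hilb n),
        ρ.IsGaussian hbar → QM.varPos u ρ = ε₁ →
          QM.varMom hbar v ρ = hbar ^ 2 / (4 * ε₁) * Real.cos α ^ 2 →
          QM.errorFn hbar u v ρ M ≤ QM.divergence hbar u v ε₁ ε₂ M ∧
          QM.errorFn hbar u v ρ M = ENNReal.ofReal
            (QM.gaussianError μ V ε₁ (hbar ^ 2 / (4 * ε₁) * Real.cos α ^ 2))) := by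
  have herr : ∀ ρ : QM.State (QM.Hilb n), ρ.IsGaussian hbar → 0 < QM.varPos u ρ →
      0 < QM.varMom hbar v ρ → QM.errorFn hbar u v ρ M =
        ENNReal.ofReal (QM.gaussianError μ V (QM.varPos u ρ) (QM.varMom hbar v ρ)) :=
    fun ρ hρ h1 h2 => QM.errorFn_eq_gaussianError hhbar hM hcov hρ h1 h2
  rw [← hα]
  refine ⟨fun h => ⟨QM.exists_gaussian_state_of_var hhbar hu hv hε₁ hε₂ h, ?_⟩, fun h => ?_⟩
  · intro ρ hρ h1 h2
    have he := herr ρ hρ (h1 ▸ hε₁) (h2 ▸ hε₂)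
    rw [h1, h2] at he
    refine ⟨le_antisymm (iSup₂_le fun ρ' hρ' => ?_) ?_, he⟩
    · obtain ⟨hg, hp, hm⟩ := hρ'
      rw [he, herr ρ' hg (hε₁.trans_le hp) (hε₂.trans_le hm)]
      exact ENNReal.ofReal_le_ofReal (QM.gaussianError_anti μ (hM.diag_nonneg _)
        (hM.diag_nonneg _) hε₁ hε₂ hp hm)
    · exact le_iSup₂_of_le ρ ⟨hρ, h1.ge, h2.ge⟩ le_rfl
  -- The momentum variance compatible with ε₁ lies above the threshold, so the state is admissible
  -- in the supremum. The pair of variances meets the existence condition with equality.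
  · have hlt : ε₂ < hbar ^ 2 / (4 * ε₁) * inner ℝ u v ^ 2 := by
      rw [div_mul_eq_mul_div, lt_div_iff₀ (by positivity)]
      linarith
    have hpos := hε₂.trans hlt
    refine ⟨QM.exists_gaussian_state_of_var hhbar hu hv hε₁ hpos (le_of_eq ?_), ?_⟩
    · field_simp
    · intro ρ hρ h1 h2
      have he := herr ρ hρ (h1 ▸ hε₁) (h2 ▸ hpos)
      rw [h1, h2] at he
      exact ⟨le_iSup₂_of_le ρ ⟨hρ, h1.ge, h2 ▸ hlt.le⟩ le_rfl, he⟩
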